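/- Let $N\ge 1$, let $\mathbb D$ be the open unit ball of $\mathbb R^{N+1}$ with its hyperbolic distance $d$ (curvature $-1$), let $\mathbb S=\partial\mathbb D$ and $\overline{\mathbb D}=\mathbb D\cup\mathbb S$. Let $G$ be a Kleinian group, that is, a discrete group of isometries of $(\mathbb D,d)$ (not necessarily orientation preserving), acting on $\overline{\mathbb D}$ by continuous extension, and let $M_G=\mathbb D/G$. The limit set $L(H)\subset\mathbb S$ of a subgroup $H\le G$ is the set of accumulation points of the orbit $H(0)$. An end of $M_G$ is a connected open set $E\subset M_G$ with compact non-empty boundary and non-compact closure. Let $E^0_i$ ($i\in I$) be the connected components of the preimage of $E$ in $\mathbb D$ and let $G_i=\{g\in G: g(E^0_i)=E^0_i\}$. A point $\zeta\in\mathbb S$ is an endpoint of $E^0_i$ if every hyperbolic geodesic ray $\beta$ towards $\zeta$ is eventually contained in $E^0_i$, with $d(x,\partial E^0_i)\to\infty$ as $x\to\zeta$ along $\beta$; it is an end limit point of $E^0_i$ if moreover $\zeta\in L(G_i)$. The end limit set of $E$ is the set of all end limit points of all the $E^0_i$, $i\in I$; its elements are called the end limit points of $E$. A (closed) Dirichlet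 fundamental domain of $G$ is a set $F=\{z\in\mathbb D: d(z,a)\le d(z,g(a))\ \forall g\in G\}$, where $a\in\mathbb D$ is not fixed by any non-trivial element of $G$. An ending sequence tending to $\zeta\in\mathbb S$ is a sequence $(z_n)$ of points of a Dirichlet fundamental domain $F$ of $G$ that converges to $\zeta$ in the Euclidean metric and all of whose members lie within a uniformly bounded hyperbolic distance of some geodesic ray towards $\zeta$ contained in $F$. For $g\in G$ and $z\in\overline{\mathbb D}$ let $j(g,z)$ be the conformal derivative of $g$ at $z$, that is, with $w=g^{-1}(0)$, $j(g,z)=\frac{1-|w|^2}{1-2\langle z,w\rangle+|z|^2|w|^2}$, and let $P(z,s)=\sum_{g\in G}j(g,z)^s$ for $z\in\mathbb D$. Let $s>0$ be such that $P(z,s)<\infty$ (this does not depend on $z\in\mathbb D$). An $s$-conformal ending measure obtained from an ending sequence $(z_n)$ is a Borel probability measure $\mu$ on $\overline{\mathbb D}$ that is the weak limit of a subsequence of the measures $$\mu_n=\frac1{P(z_n,s)}\sum_{g\in G}j(g,z_n)^s\,\mathbf 1_{g(z_n)},$$ where $\mathbf 1_x$ is the Dirac measure at $x$. **Proposition.**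 Suppose that $M_G$ has an end $E$ whose end limit set is countable. Then, for every $s>0$ for which the Poincaré series converges, every $s$-conformal ending measure obtained from any ending sequence tending to any end limit point of $E$ is purely atomic, i.e. it gives full measure to some countable set. -/

import Mathlib

open MeasureTheory Filter Topology
open scoped ENNReal Pointwise

noncomputable section

namespace ConformalEnding

/-! ### The ball model of hyperbolic space of dimension `N + 1` -/

/-- The Euclidean space of dimension `N + 1`. -/
abbrev Euc (N : ℕ) : Type := EuclideanSpace ℝ (Fin (N + 1))

/-- The open unit ball `𝔻`. -/
abbrev Disc (N : ℕ) : Type := ↥(Metric.ball (0 : Euc N) 1)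

/-- The closed unit ball, the disjoint union of `𝔻` and of the sphere at infinity `𝕊`. -/
abbrev ClosedDisc (N : ℕ) : Type := ↥(Metric.closedBall (0 : Euc N) 1)

/-- The inclusion of `𝔻` in the closed ball. -/
def incl {N : ℕ} (z : Disc N) : ClosedDisc N :=
  ⟨z.1, Metric.ball_subset_closedBall z.2⟩

/-- The centre of the ball, as a point of `𝔻`. -/
def origin (N : ℕ) : Disc N := ⟨0, Metric.mem_ball_self one_pos⟩

/-- The hyperbolic distance (of curvature `-1`) between two points of the open unit ball. -/
def hdist {N : ℕ} (x y : Euc N) : ℝ :=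
  Real.arcosh (1 + 2 * ‖x - y‖ ^ 2 / ((1 - ‖x‖ ^ 2) * (1 - ‖y‖ ^ 2)))

/-- The homeomorphisms of the closed ball that map `𝔻` to itself and are isometric there for the
hyperbolic distance: hyperbolic isometries with their (unique) continuous extension to `𝕊`. -/
def hypIsometries (N : ℕ) : Subgroup (ClosedDisc N ≃ₜ ClosedDisc N) where
  carrier := {g | (∀ x : ClosedDisc N, ‖(g x : Euc N)‖ < 1 ↔ ‖(x : Euc N)‖ < 1) ∧
    ∀ x y : ClosedDisc N, ‖(x : Euc N)‖ < 1 → ‖(y : Euc N)‖ < 1 →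
      hdist (g x : Euc N) (g y : Euc N) = hdist (x : Euc N) (y : Euc N)}
  mul_mem' := by
    rintro a b ⟨ha, ha'⟩ ⟨hb, hb'⟩
    refine ⟨fun x => (ha (b x)).trans (hb x), fun x y hx hy => ?_⟩
    exact (ha' (b x) (b y) ((hb x).2 hx) ((hb y).2 hy)).trans (hb' x y hx hy)
  one_mem' := ⟨fun _ => Iff.rfl, fun _ _ _ _ => rfl⟩
  inv_mem' := by
    rintro a ⟨ha, ha'⟩
    have key : ∀ x : ClosedDisc N, a (a⁻¹ x) = x := fun x => a.apply_symm_apply x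
    have h1 : ∀ x : ClosedDisc N, ‖((a⁻¹ : ClosedDisc N ≃ₜ ClosedDisc N) x : Euc N)‖ < 1 ↔
        ‖(x : Euc N)‖ < 1 := fun x => by
      have := ha (a⁻¹ x)
      rw [key] at this
      exact this.symm
    refine ⟨h1, fun x y hx hy => ?_⟩
    have := ha' (a⁻¹ x) (a⁻¹ y) ((h1 x).2 hx) ((h1 y).2 hy)
    rw [key, key] at this
    exact this.symm

/-- The isometry group of hyperbolic space, acting on the closed ball. -/
abbrev Mob (N : ℕ) : Type := ↥(hypIsometries N)

instance (N : ℕ) : MulAction (Mob N) (ClosedDisc N) where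
  smul g x := (g : ClosedDisc N ≃ₜ ClosedDisc N) x
  one_smul _ := rfl
  mul_smul _ _ _ := rfl

theorem norm_smul_lt_one {N : ℕ} (g : Mob N) (z : Disc N) :
    ‖((g • incl z : ClosedDisc N) : Euc N)‖ < 1 :=
  (g.2.1 (incl z)).2 (mem_ball_zero_iff.1 z.2)

instance (N : ℕ) : MulAction (Mob N) (Disc N) where
  smul g z := ⟨(g • incl z : ClosedDisc N), mem_ball_zero_iff.2 (norm_smul_lt_one g z)⟩
  one_smul _ := rfl
  mul_smul _ _ _ := rfl

/-- A group of hyperbolic isometries is discrete if the identity is isolated in it, for the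
topology of uniform convergence on the closed ball. -/
def IsKleinian {N : ℕ} (G : Subgroup (Mob N)) : Prop :=
  ∃ ε : ℝ, 0 < ε ∧ ∀ g ∈ G, (∀ x : ClosedDisc N, dist (g • x) x < ε) → g = 1

/-- The limit set: the accumulation points in the closed ball of the orbit of the centre. -/
def limitSet {N : ℕ} (G : Subgroup (Mob N)) : Set (ClosedDisc N) :=
  derivedSet {x | ∃ g ∈ G, x = g • incl (origin N)}

/-- The conformal derivative `j(g, z) = (1 - |w|²) / (|z* - w|² |z|²)`, where `w = g⁻¹(0)` and `z*`
is the image of `z` under the reflection at `𝕊`. The denominator is expanded, so that it also has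
its right value `1` at `z = 0`. -/
def conformalDeriv {N : ℕ} (g : Mob N) (z : ClosedDisc N) : ℝ :=
  let w : Euc N := (g⁻¹ • origin N : Disc N)
  (1 - ‖w‖ ^ 2) / (1 - 2 * inner ℝ (z : Euc N) w + ‖(z : Euc N)‖ ^ 2 * ‖w‖ ^ 2)

/-- The Poincaré series `P(z, s)`. -/
def poincareSeries {N : ℕ} (G : Subgroup (Mob N)) (z : Disc N) (s : ℝ) : ℝ≥0∞ :=
  ∑' g : G, ENNReal.ofReal (conformalDeriv (g : Mob N) (incl z) ^ s)

/-! ### Geodesic rays and ends -/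

/-- `β`, restricted to `[0, ∞)`, is a hyperbolic geodesic ray, of unit speed, towards `ζ`. -/
def IsRayTowards {N : ℕ} (β : ℝ → Disc N) (ζ : ClosedDisc N) : Prop :=
  (∀ t u : ℝ, 0 ≤ t → 0 ≤ u → hdist (β t : Euc N) (β u : Euc N) = |t - u|) ∧
    Tendsto (fun t => incl (β t)) atTop (𝓝 ζ)

/-- The quotient space `M_G = 𝔻 / G`, with the quotient topology. -/
abbrev Orbifold {N : ℕ} (G : Subgroup (Mob N)) : Type :=
  Quotient (MulAction.orbitRel G (Disc N))

/-- The projection of `𝔻` to `M_G`. -/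
def proj {N : ℕ} (G : Subgroup (Mob N)) (z : Disc N) : Orbifold G :=
  Quotient.mk (MulAction.orbitRel G (Disc N)) z

/-- An end of `M_G`: a connected open subset with compact non-empty boundary and with non-compact
closure. -/
structure IsEnd {N : ℕ} (G : Subgroup (Mob N)) (E : Set (Orbifold G)) : Prop where
  isConnected : IsConnected E
  isOpen : IsOpen E
  isCompact_frontier : IsCompact (frontier E)
  nonempty_frontier : (frontier E).Nonempty
  not_isCompact_closure : ¬ IsCompact (closure E)

/-- `C` is a connected component of the lift of `E` to `𝔻`, that is, an end of `G`. -/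
def IsLift {N : ℕ} (G : Subgroup (Mob N)) (E : Set (Orbifold G)) (C : Set (Disc N)) : Prop :=
  ∃ x ∈ proj G ⁻¹' E, C = connectedComponentIn (proj G ⁻¹' E) x

/-- The end group of an end `C` of `G`: the stabiliser of the set `C` in `G`. -/
def endGroup {N : ℕ} (G : Subgroup (Mob N)) (C : Set (Disc N)) : Subgroup (Mob N) :=
  G ⊓ MulAction.stabilizer (Mob N) C

/-- `ζ ∈ 𝕊` is an endpoint of `C` if every geodesic ray towards `ζ` is eventually contained in `C`,
with hyperbolic distance to the boundary of `C` in `𝔻` tending to infinity. -/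
def IsEndpoint {N : ℕ} (C : Set (Disc N)) (ζ : ClosedDisc N) : Prop :=
  ‖(ζ : Euc N)‖ = 1 ∧ ∀ β : ℝ → Disc N, IsRayTowards β ζ →
    (∀ᶠ t in atTop, β t ∈ C) ∧
      ∀ R : ℝ, ∀ᶠ t in atTop, ∀ y ∈ frontier C, R ≤ hdist (β t : Euc N) (y : Euc N)

/-- The end limit set of the end `E` of `M_G`: the points that are, for some component `C` of the
lift of `E`, endpoints of `C` and limit points of the end group of `C`. -/
def endLimitSet {N : ℕ} (G : Subgroup (Mob N)) (E : Set (Orbifold G)) : Set (ClosedDisc N) :=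
  {ζ | ∃ C : Set (Disc N), IsLift G E C ∧ IsEndpoint C ζ ∧ ζ ∈ limitSet (endGroup G C)}

/-! ### Conformal ending measures -/

/-- The (closed) Dirichlet fundamental domain of `G` centred at `a`; here `a` is not fixed by a
non-trivial element of `G`. -/
def IsDirichletDomain {N : ℕ} (G : Subgroup (Mob N)) (F : Set (Disc N)) : Prop :=
  ∃ a : Disc N, (∀ g ∈ G, g • a = a → g = 1) ∧
    F = {z : Disc N | ∀ g ∈ G, hdist (z : Euc N) (a : Euc N) ≤
      hdist (z : Euc N) ((g • a : Disc N) : Euc N)}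

/-- `(z n)` is an ending sequence tending to `ζ`: it is contained in a Dirichlet domain `F`, tends
to `ζ`, and stays within bounded hyperbolic distance of a geodesic ray towards `ζ` in `F`. -/
def IsEndingSequence {N : ℕ} (G : Subgroup (Mob N)) (z : ℕ → Disc N) (ζ : ClosedDisc N) : Prop :=
  ∃ F : Set (Disc N), IsDirichletDomain G F ∧ (∀ n, z n ∈ F) ∧
    Tendsto (fun n => incl (z n)) atTop (𝓝 ζ) ∧
    ∃ β : ℝ → Disc N, IsRayTowards β ζ ∧ (∀ t : ℝ, 0 ≤ t → β t ∈ F) ∧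
      ∃ K : ℝ, ∀ n, ∃ t : ℝ, 0 ≤ t ∧ hdist (z n : Euc N) (β t : Euc N) ≤ K

/-- The measure `P(z, s)⁻¹ ∑ j(g, z)^s 1_{g(z)}`, the sum being over `g ∈ G`. -/
def orbitMeasure {N : ℕ} (G : Subgroup (Mob N)) (s : ℝ) (z : Disc N) : Measure (ClosedDisc N) :=
  (poincareSeries G z s)⁻¹ • Measure.sum fun g : G =>
    ENNReal.ofReal (conformalDeriv (g : Mob N) (incl z) ^ s) •
      Measure.dirac ((g : Mob N) • incl z)

/-- `μ` is an `s`-conformal ending measure obtained from the sequence `(z n)`: the exponent `s > 0`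
is such that the Poincaré series converges, and `μ` is a probability measure that is the weak limit
of a subsequence of the orbit measures at the points `z n`. -/
structure IsConformalEndingMeasure {N : ℕ} (G : Subgroup (Mob N)) (s : ℝ) (z : ℕ → Disc N)
    (μ : Measure (ClosedDisc N)) : Prop where
  exponent_pos : 0 < s
  converges : ∃ x : Disc N, poincareSeries G x s < ∞
  isProbabilityMeasure : IsProbabilityMeasure μ
  weakLimit : ∃ φ : ℕ → ℕ, StrictMono φ ∧ ∀ f : C(ClosedDisc N, ℝ),
    Tendsto (fun n => ∫ x, f x ∂(orbitMeasure G s (z (φ n)))) atTop (𝓝 (∫ x, f x ∂μ))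

/-- A Borel measure is purely atomic if it is carried by a countable set of points. -/
def IsPurelyAtomic {N : ℕ} (μ : Measure (ClosedDisc N)) : Prop :=
  ∃ A : Set (ClosedDisc N), A.Countable ∧ μ Aᶜ = 0

end ConformalEnding

end

/-! Every point `ξ` of the sphere is the end of a ray from the origin, and `μ`-almost every `ξ`
turns out to be an end limit point of `E`. The tool is a shadow estimate: the `μ_n`-mass of the
shadow of `g(0)`, seen from the origin, is at most a constant times `j(g, 0)^s`. As the Poincaré
series converges, the shadows of the orbit points far from the origin have small mass, uniformly in
`n`.

Let `W ⊆ 𝔻` be the preimage of `E`. The frontier of `E` is compact, so the frontier of `W` lies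
within a bounded distance of the orbit `G(0)`. All the orbits `G(z_n)`, `n` large, lie in `W`. If
the ray towards `ξ` returned again and again to a bounded distance of the complement of `W`, then
for `k z_n` near `ξ` the segment from the origin to `k z_n` would pass near the frontier of `W` far
from the origin, so that `k z_n` would lie in the shadow of a far-away `g(0)`. The set of such `ξ`
is therefore null, and almost every `ξ` is an endpoint of some component `C'` of `W`.

If `ξ` is not a limit point of the stabiliser of `C'` in `G`, then no `k z_n` with `n` large lies in
`C'` near `ξ`. Indeed, the `z_n` lie in a Dirichlet domain with centre `a`, so that `k z_n` is no
farther from `k a` than from `a`. Hence if `k → ∞`, then `k a` tends to `ξ` along with `k z_n`,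
which makes `ξ` a limit point, and if `k` is constant, then `ξ` is the image under `k` of the end
limit point `ζ`. So the shadow estimate, applied to `C'` in place of the complement of `W`, shows
that the set of these `ξ` is null as well. -/

noncomputable section

namespace ConformalEnding

open Real (exp sinh cosh tanh)

variable {N : ℕ}

/-- The hyperbolic distance of two points of `𝔻`, with the coercions left out. -/
local notation "d(" x "," y ")" => hdist (Subtype.val (x : Disc _)) (Subtype.val (y : Disc _))

section InnerProductSpace

variable {V : Type*} [NormedAddCommGroup V] [InnerProductSpace ℝ V]

/-- The square of `‖y‖ * ‖x - y*‖`, where `y*` is the image of `y` under the inversion in the unit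
sphere. It is expanded so as to have its right value `1` at `y = 0`, and is then the denominator of
`conformalDeriv`. -/
def reflDistSq (x y : V) : ℝ := 1 - 2 * inner ℝ x y + ‖x‖ ^ 2 * ‖y‖ ^ 2

theorem reflDistSq_comm (x y : V) : reflDistSq x y = reflDistSq y x := by
  rw [reflDistSq, reflDistSq, real_inner_comm, mul_comm (‖x‖ ^ 2)]

theorem reflDistSq_eq_norm_sub_sq_add (x y : V) :
    reflDistSq x y = ‖x - y‖ ^ 2 + (1 - ‖x‖ ^ 2) * (1 - ‖y‖ ^ 2) := by
  rw [reflDistSq, norm_sub_sq_real]; ring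

theorem sqrt_reflDistSq (x : V) {y : V} (hy : y ≠ 0) :
    √(reflDistSq x y) = ‖y‖ * ‖x - (‖y‖ ^ 2)⁻¹ • y‖ := by
  have hy' : ‖y‖ ≠ 0 := norm_ne_zero_iff.2 hy
  rw [← Real.sqrt_sq (by positivity : 0 ≤ ‖y‖ * ‖x - (‖y‖ ^ 2)⁻¹ • y‖), mul_pow, norm_sub_sq_real,
    inner_smul_right, norm_smul, norm_inv, norm_pow, norm_norm, reflDistSq]
  congr 1
  field_simp
  ring

/-- Ptolemy's inequality for `x`, `y`, `z` and the inverse point of `y`. -/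
theorem norm_sub_mul_le_mul_sqrt_reflDistSq (x y z : V) :
    ‖x - z‖ * (1 - ‖y‖ ^ 2) ≤
      ‖x - y‖ * √(reflDistSq y z) + √(reflDistSq x y) * ‖y - z‖ := by
  rcases eq_or_ne y 0 with rfl | hy
  · simpa [reflDistSq] using norm_sub_le x z
  · have hyy : 1 - ‖y‖ ^ 2 ≤ ‖y‖ * ‖y - (‖y‖ ^ 2)⁻¹ • y‖ := by
      rw [← sqrt_reflDistSq y hy, reflDistSq_eq_norm_sub_sq_add, sub_self, norm_zero]
      exact Real.le_sqrt_of_sq_le (by linarith)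
    have ptolemy := EuclideanGeometry.mul_dist_le_mul_dist_add_mul_dist x y z ((‖y‖ ^ 2)⁻¹ • y)
    simp only [dist_eq_norm] at ptolemy
    rw [reflDistSq_comm y z, sqrt_reflDistSq x hy, sqrt_reflDistSq z hy]
    calc ‖x - z‖ * (1 - ‖y‖ ^ 2) ≤ ‖x - z‖ * (‖y‖ * ‖y - (‖y‖ ^ 2)⁻¹ • y‖) := by gcongr
      _ = ‖y‖ * (‖x - z‖ * ‖y - (‖y‖ ^ 2)⁻¹ • y‖) := mul_left_comm _ _ _
      _ ≤ ‖y‖ * (‖x - y‖ * ‖z - (‖y‖ ^ 2)⁻¹ • y‖ + ‖y - z‖ * ‖x - (‖y‖ ^ 2)⁻¹ • y‖) := by gcongr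
      _ = _ := by rw [mul_add, mul_left_comm, mul_left_comm, mul_comm ‖y - z‖, mul_assoc]

end InnerProductSpace

section HyperbolicDistance

/-- The quantity `1 - |x|²`, which is comparable to `exp (-d (0, x))`. -/
def depth (x : Disc N) : ℝ := 1 - ‖(x : Euc N)‖ ^ 2

theorem depth_pos (x : Disc N) : 0 < depth x :=
  sub_pos.2 (pow_lt_one₀ (norm_nonneg _) (mem_ball_zero_iff.1 x.2) two_ne_zero)

theorem depth_le_one (x : Disc N) : depth x ≤ 1 := sub_le_self _ (sq_nonneg _)

theorem depth_origin : depth (origin N) = 1 := by simp [depth, origin]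

theorem continuous_depth : Continuous (depth (N := N)) := by
  unfold depth; fun_prop

theorem reflDistSq_eq_norm_sub_sq_add_depth_mul (x y : Disc N) :
    reflDistSq (x : Euc N) y = ‖(x : Euc N) - y‖ ^ 2 + depth x * depth y :=
  reflDistSq_eq_norm_sub_sq_add _ _

theorem hdist_eq_arcosh (x y : Disc N) :
    d(x, y) = Real.arcosh (1 + 2 * ‖(x : Euc N) - y‖ ^ 2 / (depth x * depth y)) := rfl

theorem hdist_nonneg (x y : Disc N) : 0 ≤ d(x, y) :=
  Real.arcosh_nonneg (le_add_of_nonneg_right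
    (div_nonneg (by positivity) (mul_pos (depth_pos x) (depth_pos y)).le))

theorem hdist_comm (x y : Disc N) : d(x, y) = d(y, x) := by
  rw [hdist, hdist, norm_sub_rev, mul_comm (1 - ‖(x : Euc N)‖ ^ 2)]

theorem hdist_self (x : Disc N) : d(x, x) = 0 := by simp [hdist]

theorem cosh_hdist_sub_one_mul (x y : Disc N) :
    (cosh d(x, y) - 1) * (depth x * depth y) = 2 * ‖(x : Euc N) - y‖ ^ 2 := by
  have h := mul_pos (depth_pos x) (depth_pos y)
  rw [hdist_eq_arcosh, Real.cosh_arcosh (le_add_of_nonneg_right (div_nonneg (by positivity) h.le)),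
    add_sub_cancel_left, div_mul_cancel₀ _ h.ne']

theorem sq_sinh_half_hdist_mul (x y : Disc N) :
    sinh (d(x, y) / 2) ^ 2 * (depth x * depth y) = ‖(x : Euc N) - y‖ ^ 2 := by
  have h := Real.cosh_two_mul (d(x, y) / 2)
  rw [mul_div_cancel₀ _ two_ne_zero, Real.cosh_sq] at h
  linear_combination (1 / 2) * cosh_hdist_sub_one_mul x y - (depth x * depth y / 2) * h

theorem sq_cosh_half_hdist_mul (x y : Disc N) :
    cosh (d(x, y) / 2) ^ 2 * (depth x * depth y) = reflDistSq (x : Euc N) y := by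
  rw [Real.cosh_sq, add_mul, sq_sinh_half_hdist_mul, one_mul,
    reflDistSq_eq_norm_sub_sq_add_depth_mul]

theorem sinh_half_hdist_mul_sqrt (x y : Disc N) :
    sinh (d(x, y) / 2) * √(depth x * depth y) = ‖(x : Euc N) - y‖ := by
  have h : 0 ≤ sinh (d(x, y) / 2) :=
    Real.sinh_nonneg_iff.2 (div_nonneg (hdist_nonneg x y) two_pos.le)
  rw [← Real.sqrt_sq (norm_nonneg ((x : Euc N) - y)), ← sq_sinh_half_hdist_mul,
    Real.sqrt_mul (sq_nonneg _), Real.sqrt_sq h]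

theorem cosh_half_hdist_mul_sqrt (x y : Disc N) :
    cosh (d(x, y) / 2) * √(depth x * depth y) = √(reflDistSq (x : Euc N) y) := by
  rw [← sq_cosh_half_hdist_mul, Real.sqrt_mul (sq_nonneg _), Real.sqrt_sq (Real.cosh_pos _).le]

theorem hdist_triangle (x y z : Disc N) : d(x, z) ≤ d(x, y) + d(y, z) := by
  have hx := depth_pos x
  have hy := depth_pos y
  have hz := depth_pos z
  have hmul : √(depth x * depth y) * √(depth y * depth z) = √(depth x * depth z) * depth y := by
    rw [← Real.sqrt_mul (by positivity), ← Real.sqrt_sq hy.le, ← Real.sqrt_mul (by positivity),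
      Real.sqrt_sq hy.le]
    congr 1; ring
  suffices h : sinh (d(x, z) / 2) ≤ sinh (d(x, y) / 2 + d(y, z) / 2) by
    linarith [Real.sinh_le_sinh.1 h]
  refine le_of_mul_le_mul_right ?_ (by positivity : 0 < √(depth x * depth z) * depth y)
  calc sinh (d(x, z) / 2) * (√(depth x * depth z) * depth y)
      = ‖(x : Euc N) - z‖ * (1 - ‖(y : Euc N)‖ ^ 2) := by
        rw [← mul_assoc, sinh_half_hdist_mul_sqrt, depth]
    _ ≤ ‖(x : Euc N) - y‖ * √(reflDistSq (y : Euc N) z) +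
          √(reflDistSq (x : Euc N) y) * ‖(y : Euc N) - z‖ :=
        norm_sub_mul_le_mul_sqrt_reflDistSq _ _ _
    _ = sinh (d(x, y) / 2 + d(y, z) / 2) * (√(depth x * depth z) * depth y) := by
        rw [Real.sinh_add, ← hmul, ← sinh_half_hdist_mul_sqrt, ← sinh_half_hdist_mul_sqrt,
          ← cosh_half_hdist_mul_sqrt, ← cosh_half_hdist_mul_sqrt]
        ring

theorem continuous_hdist_left (y : Disc N) : Continuous fun x : Disc N => d(x, y) := by
  have hpos (x : Disc N) : 0 < depth x * depth y := mul_pos (depth_pos x) (depth_pos y)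
  have hquot : Continuous fun x : Disc N =>
      1 + 2 * ‖(x : Euc N) - y‖ ^ 2 / (depth x * depth y) :=
    continuous_const.add (Continuous.div (by fun_prop) (continuous_depth.mul continuous_const)
      fun x => (hpos x).ne')
  exact Real.continuousOn_arcosh.comp_continuous hquot fun x =>
    le_add_of_nonneg_right (div_nonneg (by positivity) (hpos x).le)

theorem exp_le_four_mul_sq_cosh_half (t : ℝ) : exp t ≤ 4 * cosh (t / 2) ^ 2 := by
  have h : exp t = exp (t / 2) ^ 2 := by rw [← Real.exp_nat_mul]; congr 1; push_cast; ring
  rw [h, Real.cosh_eq]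
  nlinarith [Real.exp_pos (t / 2), Real.exp_pos (-(t / 2))]

theorem sq_cosh_half_le_exp {t : ℝ} (ht : 0 ≤ t) : cosh (t / 2) ^ 2 ≤ exp t := by
  have h : exp t = exp (t / 2) ^ 2 := by rw [← Real.exp_nat_mul]; congr 1; push_cast; ring
  have hle : exp (-(t / 2)) ≤ exp (t / 2) := Real.exp_le_exp.2 (by linarith)
  rw [h, Real.cosh_eq]
  gcongr
  linarith

theorem sq_cosh_half_hdist_origin_mul_depth (x : Disc N) :
    cosh (d(origin N, x) / 2) ^ 2 * depth x = 1 := by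
  have h : reflDistSq (origin N : Euc N) x = 1 := by simp [reflDistSq, origin]
  rw [← sq_cosh_half_hdist_mul, depth_origin, one_mul] at h
  exact h

theorem depth_le_exp_neg (x : Disc N) : depth x ≤ 4 * exp (-d(origin N, x)) := by
  have hx := depth_pos x
  rw [Real.exp_neg, ← div_eq_mul_inv, le_div_iff₀ (Real.exp_pos _)]
  calc depth x * exp d(origin N, x) ≤ depth x * (4 * cosh (d(origin N, x) / 2) ^ 2) := by
        gcongr; exact exp_le_four_mul_sq_cosh_half _
    _ = 4 := by linear_combination 4 * sq_cosh_half_hdist_origin_mul_depth x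

theorem exp_neg_le_depth (x : Disc N) : exp (-d(origin N, x)) ≤ depth x := by
  rw [Real.exp_neg, inv_le_iff_one_le_mul₀' (Real.exp_pos _)]
  calc 1 = cosh (d(origin N, x) / 2) ^ 2 * depth x := (sq_cosh_half_hdist_origin_mul_depth x).symm
    _ ≤ exp d(origin N, x) * depth x := by
        have := (depth_pos x).le
        gcongr
        exact sq_cosh_half_le_exp (hdist_nonneg _ _)

theorem depth_le_mul_depth (x y : Disc N) : depth y ≤ 4 * exp d(x, y) * depth x :=
  calc depth y ≤ 4 * exp (-d(origin N, y)) := depth_le_exp_neg y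
    _ ≤ 4 * exp (d(x, y) + -d(origin N, x)) := by
        gcongr; linarith [hdist_triangle (origin N) y x, hdist_comm x y]
    _ = 4 * exp d(x, y) * exp (-d(origin N, x)) := by rw [Real.exp_add]; ring
    _ ≤ 4 * exp d(x, y) * depth x := by gcongr; exact exp_neg_le_depth x

theorem norm_sub_sq_le_exp_mul (x y : Disc N) :
    ‖(x : Euc N) - y‖ ^ 2 ≤ exp d(x, y) * (depth x * depth y) := by
  have h := (mul_pos (depth_pos x) (depth_pos y)).le
  rw [← sq_sinh_half_hdist_mul]
  gcongr
  exact (by linarith [Real.cosh_sq (d(x, y) / 2)] : _ ≤ cosh (d(x, y) / 2) ^ 2).trans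
    (sq_cosh_half_le_exp (hdist_nonneg x y))

theorem norm_sub_sq_le_mul_depth (x y : Disc N) :
    ‖(x : Euc N) - y‖ ^ 2 ≤ exp d(x, y) * depth x := by
  refine (norm_sub_sq_le_exp_mul x y).trans ?_
  gcongr
  exact mul_le_of_le_one_right (depth_pos x).le (depth_le_one y)

end HyperbolicDistance

section Segments

theorem sinh_half_hdist_origin_mul_sqrt_depth (x : Disc N) :
    sinh (d(origin N, x) / 2) * √(depth x) = ‖(x : Euc N)‖ := by
  have h := sinh_half_hdist_mul_sqrt (origin N) x
  rwa [depth_origin, one_mul, norm_sub_rev, origin, sub_zero] at h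

theorem cosh_half_hdist_origin_mul_sqrt_depth (x : Disc N) :
    cosh (d(origin N, x) / 2) * √(depth x) = 1 := by
  rw [← Real.sqrt_sq (Real.cosh_pos (d(origin N, x) / 2)).le, ← Real.sqrt_mul (sq_nonneg _),
    sq_cosh_half_hdist_origin_mul_depth, Real.sqrt_one]

theorem tanh_half_hdist_origin (x : Disc N) : tanh (d(origin N, x) / 2) = ‖(x : Euc N)‖ := by
  rw [Real.tanh_eq_sinh_div_cosh, div_eq_iff (Real.cosh_pos _).ne',
    ← sinh_half_hdist_origin_mul_sqrt_depth, mul_assoc, mul_comm (√_),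
    cosh_half_hdist_origin_mul_sqrt_depth, mul_one]

/-- For half distances `a` of `p` and `b` of `x` to the origin, `|x| - |p| = tanh b - tanh a`, and
`cosh a * cosh b * (tanh b - tanh a) = sinh (b - a)`. -/
theorem hdist_origin_add_hdist_of_wbtw {p x : Disc N} (h : Wbtw ℝ (0 : Euc N) p x) :
    d(origin N, p) + d(p, x) = d(origin N, x) := by
  have hnorm : ‖(p : Euc N) - x‖ = ‖(x : Euc N)‖ - ‖(p : Euc N)‖ := by
    have := h.dist_add_dist
    rw [dist_zero_left, dist_zero_left, dist_eq_norm] at this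
    linarith
  have hp := cosh_half_hdist_origin_mul_sqrt_depth p
  have hx := cosh_half_hdist_origin_mul_sqrt_depth x
  have hsqrt : 0 < √(depth p * depth x) := Real.sqrt_pos.2 (mul_pos (depth_pos p) (depth_pos x))
  suffices hsinh : sinh (d(p, x) / 2) = sinh (d(origin N, x) / 2 - d(origin N, p) / 2) by
    linarith [Real.sinh_injective hsinh]
  refine mul_right_cancel₀ hsqrt.ne' ?_
  rw [sinh_half_hdist_mul_sqrt, hnorm, ← sinh_half_hdist_origin_mul_sqrt_depth,
    ← sinh_half_hdist_origin_mul_sqrt_depth, Real.sinh_sub, Real.sqrt_mul (depth_pos p).le]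
  linear_combination (-sinh (d(origin N, x) / 2) * √(depth x)) * hp +
    (sinh (d(origin N, p) / 2) * √(depth p)) * hx

theorem isPreconnected_preimage_val_of_convex {s : Set (Euc N)} (hs : Convex ℝ s) :
    IsPreconnected (Subtype.val ⁻¹' s : Set (Disc N)) := by
  rw [← Topology.IsInducing.subtypeVal.isPreconnected_image, Subtype.image_preimage_coe]
  exact ((convex_ball _ _).inter hs).isPreconnected

theorem hdist_lt_iff_norm_sub_sq_lt (x y : Disc N) {R : ℝ} (hR : 0 ≤ R) :
    d(x, y) < R ↔ ‖(x : Euc N) - y‖ ^ 2 < sinh (R / 2) ^ 2 * (depth x * depth y) := by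
  have h := div_nonneg (hdist_nonneg x y) two_pos.le
  rw [← sq_sinh_half_hdist_mul, mul_lt_mul_iff_left₀ (mul_pos (depth_pos x) (depth_pos y)),
    sq_lt_sq₀ (Real.sinh_nonneg_iff.2 h) (Real.sinh_nonneg_iff.2 (by linarith)),
    Real.sinh_lt_sinh, div_lt_div_iff_of_pos_right two_pos]

/-- Hyperbolic balls are Euclidean balls, hence convex in the Euclidean sense. -/
theorem isPreconnected_setOf_hdist_lt (p : Disc N) (R : ℝ) :
    IsPreconnected {y : Disc N | d(p, y) < R} := by
  rcases lt_or_ge R 0 with hR | hR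
  · convert isPreconnected_empty
    exact Set.eq_empty_of_forall_notMem fun y hy => absurd (hR.trans' hy) (hdist_nonneg p y).not_gt
  set c := sinh (R / 2) ^ 2 * depth p
  have hc : 0 ≤ c := mul_nonneg (sq_nonneg _) (depth_pos p).le
  have hconvex : ConvexOn ℝ Set.univ fun y : Euc N => dist y p ^ 2 + c • ‖y‖ ^ 2 :=
    ((convexOn_univ_dist _).pow (fun _ _ => dist_nonneg) 2).add
      ((convexOn_univ_norm.pow (fun _ _ => norm_nonneg _) 2).smul hc)
  convert isPreconnected_preimage_val_of_convex (hconvex.convex_lt c) using 1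
  ext y
  rw [Set.mem_ofPred_eq, hdist_lt_iff_norm_sub_sq_lt p y hR, ← mul_assoc]
  simp only [depth, Set.mem_preimage, Set.mem_ofPred_eq, Set.mem_univ, true_and, smul_eq_mul,
    dist_eq_norm', c]
  constructor <;> intro h <;> linarith

end Segments

section Shadows

/-- The shadow of `y` from the origin, up to the error `C`: the points `x` for which a detour
through `y` lengthens the way from the origin by at most `C`. -/
def shadow (C : ℝ) (y : Disc N) : Set (Disc N) :=
  {x | d(origin N, y) + d(y, x) ≤ d(origin N, x) + C}

theorem mem_shadow_zero_of_wbtw {p x : Disc N} (h : Wbtw ℝ (0 : Euc N) p x) : x ∈ shadow 0 p := by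
  rw [shadow, Set.mem_ofPred_eq, add_zero]
  exact (hdist_origin_add_hdist_of_wbtw h).le

theorem mem_shadow_of_hdist_le {x y y' : Disc N} {C R : ℝ} (hx : x ∈ shadow C y)
    (hR : d(y, y') ≤ R) : x ∈ shadow (C + 2 * R) y' := by
  simp only [shadow, Set.mem_ofPred_eq] at hx ⊢
  linarith [hdist_triangle (origin N) y y', hdist_triangle y' y x, hdist_comm y y']

theorem depth_le_of_mem_shadow {x y : Disc N} {C : ℝ} (h : x ∈ shadow C y) :
    depth x ≤ 4 * exp C * depth y * exp (-d(y, x)) :=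
  calc depth x ≤ 4 * exp (-d(origin N, x)) := depth_le_exp_neg x
    _ ≤ 4 * exp (C + -d(origin N, y) + -d(y, x)) := by
        have : d(origin N, y) + d(y, x) ≤ d(origin N, x) + C := h
        gcongr; linarith
    _ = 4 * exp C * exp (-d(origin N, y)) * exp (-d(y, x)) := by
        rw [Real.exp_add, Real.exp_add]; ring
    _ ≤ 4 * exp C * depth y * exp (-d(y, x)) := by gcongr; exact exp_neg_le_depth y

theorem norm_sub_sq_le_of_mem_shadow {x y : Disc N} {C : ℝ} (h : x ∈ shadow C y) :
    ‖(y : Euc N) - x‖ ^ 2 ≤ 4 * exp C * depth y ^ 2 := by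
  have hy := (depth_pos y).le
  calc ‖(y : Euc N) - x‖ ^ 2 ≤ exp d(y, x) * (depth y * depth x) := norm_sub_sq_le_exp_mul y x
    _ ≤ exp d(y, x) * (depth y * (4 * exp C * depth y * exp (-d(y, x)))) := by
        gcongr; exact depth_le_of_mem_shadow h
    _ = exp (d(y, x) + -d(y, x)) * (4 * exp C * depth y ^ 2) := by rw [Real.exp_add]; ring
    _ = 4 * exp C * depth y ^ 2 := by rw [add_neg_cancel, Real.exp_zero, one_mul]

end Shadows

section Rays

/-- For `|ξ| = 1`, the geodesic ray from the origin towards `ξ`, parametrised by arc length on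
`[0, ∞)`. For `|ξ| < 1` it runs through a part of the segment from the origin to `ξ`; these `ξ` are
allowed because nearby points of the sphere and of the ball have nearby rays. -/
def ray (ξ : ClosedDisc N) (t : ℝ) : Disc N :=
  ⟨tanh (t / 2) • (ξ : Euc N), by
    rw [mem_ball_zero_iff, norm_smul, Real.norm_eq_abs]
    have hξ := mem_closedBall_zero_iff.1 ξ.2
    exact (mul_le_of_le_one_right (abs_nonneg _) hξ).trans_lt (Real.abs_tanh_lt_one _)⟩

theorem coe_ray (ξ : ClosedDisc N) (t : ℝ) : (ray ξ t : Euc N) = tanh (t / 2) • (ξ : Euc N) := rfl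

theorem continuous_ray_left (t : ℝ) : Continuous fun ξ : ClosedDisc N => ray ξ t := by
  unfold ray; fun_prop

theorem continuous_ray (ξ : ClosedDisc N) : Continuous (ray ξ) := by
  have htanh : Continuous tanh := by
    simp_rw [funext Real.tanh_eq_sinh_div_cosh]
    exact Real.continuous_sinh.div Real.continuous_cosh fun t => (Real.cosh_pos t).ne'
  unfold ray; fun_prop

theorem tanh_nonneg {t : ℝ} (ht : 0 ≤ t) : 0 ≤ tanh t := by
  rw [Real.tanh_eq_sinh_div_cosh]
  exact div_nonneg (Real.sinh_nonneg_iff.2 ht) (Real.cosh_pos t).le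

theorem wbtw_ray_incl (x : Disc N) {t : ℝ} (ht : 0 ≤ t) :
    Wbtw ℝ (0 : Euc N) (ray (incl x) t) x :=
  ⟨tanh (t / 2), ⟨tanh_nonneg (by positivity), (Real.tanh_lt_one _).le⟩, by
    simp [AffineMap.lineMap_apply, coe_ray, incl]⟩

theorem norm_ray {ξ : ClosedDisc N} (hξ : ‖(ξ : Euc N)‖ = 1) {t : ℝ} (ht : 0 ≤ t) :
    ‖(ray ξ t : Euc N)‖ = tanh (t / 2) := by
  rw [coe_ray, norm_smul, hξ, mul_one, Real.norm_of_nonneg (tanh_nonneg (by positivity))]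

theorem hdist_origin_ray {ξ : ClosedDisc N} (hξ : ‖(ξ : Euc N)‖ = 1) {t : ℝ} (ht : 0 ≤ t) :
    d(origin N, ray ξ t) = t := by
  have h := (tanh_half_hdist_origin _).trans (norm_ray hξ ht)
  linarith [Real.tanh_injective h]

/-- Points of a Stolz angle at `ξ` are close to the ray towards `ξ`. -/
theorem hdist_ray_le_of_norm_sub_le {ξ : ClosedDisc N} (hξ : ‖(ξ : Euc N)‖ = 1) {y : Disc N} {A : ℝ}
    (hA : ‖(y : Euc N) - ξ‖ ≤ A * depth y) :
    d(y, ray ξ d(origin N, y)) ≤ Real.log (4 * ((A + 1) ^ 2 + 1)) := by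
  set p := ray ξ d(origin N, y)
  have hy := depth_pos y
  have hp : (p : Euc N) = ‖(y : Euc N)‖ • (ξ : Euc N) := by
    rw [coe_ray, tanh_half_hdist_origin]
  have hdepth : depth p = depth y := by
    rw [depth, hp, norm_smul, hξ, mul_one, norm_norm, depth]
  have hξp : ‖(ξ : Euc N) - p‖ ≤ depth y := by
    have hy1 := mem_ball_zero_iff.1 y.2
    have : (ξ : Euc N) - p = (1 - ‖(y : Euc N)‖) • (ξ : Euc N) := by rw [hp]; module
    rw [this, norm_smul, hξ, Real.norm_of_nonneg (by linarith), depth]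
    nlinarith [norm_nonneg (y : Euc N)]
  have hyp : ‖(y : Euc N) - p‖ ≤ (A + 1) * depth y := by
    linarith [norm_sub_le_norm_sub_add_norm_sub (y : Euc N) ξ p]
  have hsinh : sinh (d(y, p) / 2) ^ 2 ≤ (A + 1) ^ 2 := by
    refine le_of_mul_le_mul_right ?_ (mul_pos hy hy)
    calc sinh (d(y, p) / 2) ^ 2 * (depth y * depth y) = ‖(y : Euc N) - p‖ ^ 2 := by
          rw [← sq_sinh_half_hdist_mul, hdepth]
      _ ≤ ((A + 1) * depth y) ^ 2 := by gcongr
      _ = (A + 1) ^ 2 * (depth y * depth y) := by ring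
  rw [Real.le_log_iff_exp_le (by positivity)]
  refine (exp_le_four_mul_sq_cosh_half _).trans ?_
  rw [Real.cosh_sq]
  gcongr

theorem IsRayTowards.hdist_zero_eq {β : ℝ → Disc N} {ξ : ClosedDisc N} (hβ : IsRayTowards β ξ)
    {t : ℝ} (ht : 0 ≤ t) : d(β 0, β t) = t := by
  rw [hβ.1 0 t le_rfl ht, zero_sub, abs_neg, abs_of_nonneg ht]

theorem IsRayTowards.sub_le_hdist_origin {β : ℝ → Disc N} {ξ : ClosedDisc N}
    (hβ : IsRayTowards β ξ) {t : ℝ} (ht : 0 ≤ t) :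
    t - d(origin N, β 0) ≤ d(origin N, β t) := by
  linarith [hβ.hdist_zero_eq ht, hdist_triangle (β 0) (origin N) (β t),
    hdist_comm (β 0) (origin N)]

theorem IsRayTowards.tendsto_hdist_origin {β : ℝ → Disc N} {ξ : ClosedDisc N}
    (hβ : IsRayTowards β ξ) : Tendsto (fun t => d(origin N, β t)) atTop atTop :=
  tendsto_atTop_mono' _ ((eventually_ge_atTop 0).mono fun _ => hβ.sub_le_hdist_origin)
    (tendsto_atTop_add_const_right _ _ tendsto_id)

theorem IsRayTowards.mem_shadow {β : ℝ → Disc N} {ξ : ClosedDisc N} (hβ : IsRayTowards β ξ)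
    {t u : ℝ} (ht : 0 ≤ t) (hu : t ≤ u) : β u ∈ shadow (2 * d(origin N, β 0)) (β t) := by
  have htu := hβ.1 t u ht (ht.trans hu)
  rw [abs_sub_comm, abs_of_nonneg (sub_nonneg.2 hu)] at htu
  rw [shadow, Set.mem_ofPred_eq]
  linarith [hdist_triangle (origin N) (β 0) (β t), hβ.hdist_zero_eq ht,
    hβ.sub_le_hdist_origin (ht.trans hu)]

theorem IsRayTowards.exists_hdist_ray_le {β : ℝ → Disc N} {ξ : ClosedDisc N}
    (hβ : IsRayTowards β ξ) (hξ : ‖(ξ : Euc N)‖ = 1) :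
    ∃ K : ℝ, ∀ t, 0 ≤ t → d(β t, ray ξ d(origin N, β t)) ≤ K := by
  set k := d(origin N, β 0)
  refine ⟨_, fun t ht => hdist_ray_le_of_norm_sub_le (A := 2 * exp k) hξ ?_⟩
  have hy := depth_pos (β t)
  refine le_of_sq_le_sq ?_ (by positivity)
  have hlim : Tendsto (fun u => ‖(β t : Euc N) - β u‖ ^ 2) atTop (𝓝 (‖(β t : Euc N) - ξ‖ ^ 2)) :=
    ((tendsto_const_nhds.sub ((continuous_subtype_val.tendsto ξ).comp hβ.2)).norm).pow 2
  refine le_of_tendsto hlim ((eventually_ge_atTop t).mono fun u hu => ?_)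
  calc ‖(β t : Euc N) - β u‖ ^ 2 ≤ 4 * exp (2 * k) * depth (β t) ^ 2 :=
        norm_sub_sq_le_of_mem_shadow (hβ.mem_shadow ht hu)
    _ = (2 * exp k * depth (β t)) ^ 2 := by rw [two_mul, Real.exp_add]; ring

end Rays

section Topology

variable {X : Type*} [TopologicalSpace X]

theorem exists_mem_frontier_of_isPreconnected {S V : Set X} (hS : IsPreconnected S) {a b : X}
    (ha : a ∈ S) (hb : b ∈ S) (hab : ¬ (a ∈ V ↔ b ∈ V)) : ∃ y ∈ S, y ∈ frontier V := by
  by_contra! h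
  have hcover : S ⊆ interior V ∪ (closure V)ᶜ := fun y hy => by
    by_contra hy'
    rw [Set.mem_union, not_or, Set.notMem_compl_iff] at hy'
    exact h y hy ⟨hy'.2, hy'.1⟩
  have hdisj : Disjoint (interior V) (closure V)ᶜ :=
    Set.disjoint_compl_right_iff_subset.2 (interior_subset.trans subset_closure)
  rcases hS.subset_or_subset isOpen_interior isClosed_closure.isOpen_compl hdisj hcover with hV | hV
  · exact hab (iff_of_true (interior_subset (hV ha)) (interior_subset (hV hb)))
  · exact hab (iff_of_false (fun h' => hV ha (subset_closure h')) fun h' =>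
      hV hb (subset_closure h'))

theorem frontier_connectedComponentIn_subset_compl [LocallyConnectedSpace X] {W : Set X}
    (hW : IsOpen W) (x : X) : frontier (connectedComponentIn W x) ⊆ Wᶜ := by
  rw [hW.connectedComponentIn.frontier_eq]
  rintro y ⟨hyx, hyx'⟩ hy
  obtain ⟨w, hwy, hwx⟩ := mem_closure_iff.1 hyx _ (hW.connectedComponentIn (x := y))
    (mem_connectedComponentIn hy)
  rw [connectedComponentIn_eq hwx, ← connectedComponentIn_eq hwy] at hyx'
  exact hyx' (mem_connectedComponentIn hy)

theorem frontier_connectedComponentIn_subset [LocallyConnectedSpace X] {W : Set X}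
    (hW : IsOpen W) (x : X) : frontier (connectedComponentIn W x) ⊆ frontier W := fun y hy => by
  rw [hW.frontier_eq]
  exact ⟨closure_mono (connectedComponentIn_subset _ _) hy.1,
    frontier_connectedComponentIn_subset_compl hW x hy⟩

theorem mem_iff_mem_of_hdist_lt {C : Set (Disc N)} {p y : Disc N} {R : ℝ}
    (hC : ∀ q ∈ frontier C, R ≤ d(p, q)) (hy : d(p, y) < R) : p ∈ C ↔ y ∈ C := by
  by_contra hpy
  have hp : p ∈ {y : Disc N | d(p, y) < R} := by
    rw [Set.mem_ofPred_eq, hdist_self]; exact (hdist_nonneg p y).trans_lt hy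
  obtain ⟨q, hpq, hq⟩ :=
    exists_mem_frontier_of_isPreconnected (isPreconnected_setOf_hdist_lt p R) hp hy hpy
  exact (hC q hq).not_gt hpq

instance : LocallyConnectedSpace (Disc N) := Metric.isOpen_ball.locallyConnectedSpace

end Topology

section Action

theorem hdist_smul_smul (g : Mob N) (x y : Disc N) : d(g • x, g • y) = d(x, y) :=
  g.2.2 (incl x) (incl y) (mem_ball_zero_iff.1 x.2) (mem_ball_zero_iff.1 y.2)

theorem hdist_smul_left (g : Mob N) (x y : Disc N) : d(g • x, y) = d(x, g⁻¹ • y) := by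
  rw [← hdist_smul_smul g x, smul_inv_smul]

theorem incl_smul (g : Mob N) (x : Disc N) : incl (g • x) = g • incl x := rfl

theorem continuous_incl : Continuous (incl : Disc N → ClosedDisc N) :=
  continuous_subtype_val.subtype_mk _

instance : ContinuousConstSMul (Mob N) (ClosedDisc N) where
  continuous_const_smul g := (g : ClosedDisc N ≃ₜ ClosedDisc N).continuous

instance : ContinuousConstSMul (Mob N) (Disc N) where
  continuous_const_smul g :=
    (continuous_subtype_val.comp (continuous_incl.const_smul g)).subtype_mk _

variable {G : Subgroup (Mob N)} {E : Set (Orbifold G)}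

instance : ContinuousConstSMul G (Disc N) where
  continuous_const_smul g := continuous_const_smul (g : Mob N)

theorem continuous_proj : Continuous (proj G) := continuous_quotient_mk'

theorem isOpenMap_proj : IsOpenMap (proj G) := isOpenMap_quotient_mk'_mul

theorem proj_smul {g : Mob N} (hg : g ∈ G) (x : Disc N) : proj G (g • x) = proj G x :=
  Quotient.sound ⟨(⟨g, hg⟩ : G), rfl⟩

theorem smul_preimage_proj {g : Mob N} (hg : g ∈ G) (E : Set (Orbifold G)) :
    g • (proj G ⁻¹' E) = proj G ⁻¹' E := by
  ext x
  rw [Set.mem_smul_set_iff_inv_smul_mem, Set.mem_preimage, Set.mem_preimage,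
    proj_smul (inv_mem hg)]

variable {C C' : Set (Disc N)}

theorem IsLift.isOpen (hC : IsLift G E C) (hE : IsOpen E) : IsOpen C := by
  obtain ⟨x, -, rfl⟩ := hC
  exact (hE.preimage continuous_proj).connectedComponentIn

theorem IsLift.nonempty (hC : IsLift G E C) : C.Nonempty := by
  obtain ⟨x, hx, rfl⟩ := hC
  exact ⟨x, mem_connectedComponentIn hx⟩

theorem IsLift.subset (hC : IsLift G E C) : C ⊆ proj G ⁻¹' E := by
  obtain ⟨x, -, rfl⟩ := hC
  exact connectedComponentIn_subset _ _

theorem IsLift.frontier_subset (hC : IsLift G E C) (hE : IsOpen E) :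
    frontier C ⊆ frontier (proj G ⁻¹' E) := by
  obtain ⟨x, -, rfl⟩ := hC
  exact frontier_connectedComponentIn_subset (hE.preimage continuous_proj) x

theorem IsLift.eq_connectedComponentIn (hC : IsLift G E C) {y : Disc N} (hy : y ∈ C) :
    C = connectedComponentIn (proj G ⁻¹' E) y := by
  obtain ⟨x, -, rfl⟩ := hC
  exact connectedComponentIn_eq hy

theorem countable_setOf_isLift (hE : IsOpen E) : {C | IsLift G E C}.Countable := by
  have hdisjoint : {C | IsLift G E C}.PairwiseDisjoint id := fun C hC C' hC' hne =>
    Set.disjoint_left.2 fun y hy hy' =>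
      hne ((hC.eq_connectedComponentIn hy).trans (hC'.eq_connectedComponentIn hy').symm)
  exact hdisjoint.countable_of_isOpen (fun C hC => hC.isOpen hE) fun C hC => hC.nonempty

theorem IsLift.smul_eq (hC : IsLift G E C) (hC' : IsLift G E C') {g : Mob N} (hg : g ∈ G)
    {y : Disc N} (hy : y ∈ C) (hgy : g • y ∈ C') : g • C = C' := by
  have himage := (Homeomorph.smul g : Disc N ≃ₜ Disc N).image_connectedComponentIn (hC.subset hy)
  rw [hC.eq_connectedComponentIn hy, hC'.eq_connectedComponentIn hgy]
  nth_rw 2 [← smul_preimage_proj hg E]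
  exact himage

end Action

section OrbitShadows

variable {G : Subgroup (Mob N)} {E : Set (Orbifold G)}

/-- The closed hyperbolic `ρ`-neighbourhood of the orbit of the origin. -/
def orbitThickening (G : Subgroup (Mob N)) (ρ : ℝ) : Set (Disc N) :=
  {y | ∃ g ∈ G, d(y, g • origin N) ≤ ρ}

/-- The union of the shadows of the points of the orbit of the origin at distance at least `T`
from the origin. -/
def orbitShadow (G : Subgroup (Mob N)) (T C : ℝ) : Set (Disc N) :=
  {x | ∃ g ∈ G, T ≤ d(origin N, g • origin N) ∧ x ∈ shadow C (g • origin N)}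

theorem mem_orbitThickening_of_proj_eq {x y : Disc N} {ρ : ℝ} (hxy : proj G x = proj G y)
    (hx : d(x, origin N) ≤ ρ) : y ∈ orbitThickening G ρ := by
  obtain ⟨g, rfl : (g : Mob N) • x = y⟩ := Quotient.exact hxy.symm
  exact ⟨g, g.2, by rwa [hdist_smul_smul]⟩

theorem exists_preimage_proj_subset_orbitThickening {K : Set (Orbifold G)} (hK : IsCompact K) :
    ∃ ρ, proj G ⁻¹' K ⊆ orbitThickening G ρ := by
  let ball (n : ℕ) : Set (Disc N) := {x | d(x, origin N) < n}
  have hball (n : ℕ) : IsOpen (ball n) := isOpen_lt (continuous_hdist_left _) continuous_const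
  have hopen (n : ℕ) : IsOpen (proj G '' ball n) := isOpenMap_proj _ (hball n)
  have hmono : Monotone fun n => proj G '' ball n := fun m n hmn => Set.image_mono fun x hx =>
    show d(x, origin N) < n from lt_of_lt_of_le hx (Nat.cast_le.2 hmn)
  have hcover : K ⊆ ⋃ n, proj G '' ball n := fun y _ => by
    obtain ⟨x, rfl⟩ := Quotient.exists_rep y
    obtain ⟨n, hn⟩ := exists_nat_gt d(x, origin N)
    exact Set.mem_iUnion.2 ⟨n, x, hn, rfl⟩
  obtain ⟨n, hn⟩ := hK.elim_directed_cover _ hopen hcover hmono.directed_le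
  refine ⟨n, fun y hy => ?_⟩
  obtain ⟨x, hx, hxy⟩ := hn hy
  exact mem_orbitThickening_of_proj_eq hxy (le_of_lt hx)

theorem exists_frontier_preimage_proj_subset (hE : IsCompact (frontier E)) :
    ∃ ρ, frontier (proj G ⁻¹' E) ⊆ orbitThickening G ρ := by
  obtain ⟨ρ, hρ⟩ := exists_preimage_proj_subset_orbitThickening hE
  exact ⟨ρ, (continuous_proj.frontier_preimage_subset E).trans hρ⟩

theorem mem_orbitShadow_of_wbtw {p y x : Disc N} {R ρ T : ℝ} (hp : Wbtw ℝ (0 : Euc N) p x)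
    (hT : T + (R + ρ) ≤ d(origin N, p)) (hpy : d(p, y) ≤ R) (hy : y ∈ orbitThickening G ρ) :
    x ∈ orbitShadow G T (2 * (R + ρ)) := by
  obtain ⟨g, hg, hgy⟩ := hy
  have hpg : d(p, g • origin N) ≤ R + ρ := by linarith [hdist_triangle p y (g • origin N)]
  refine ⟨g, hg, ?_, ?_⟩
  · linarith [hdist_triangle (origin N) (g • origin N) p, hdist_comm p (g • origin N)]
  · rw [← zero_add (2 * _)]
    exact mem_shadow_of_hdist_le (mem_shadow_zero_of_wbtw hp) hpg

/-- Both the ball of radius `R` around `p` and the segment from `p` to `x` are connected, so one of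
them meets the frontier of `V`. -/
theorem mem_orbitShadow_of_mem_of_notMem {V : Set (Disc N)} {ρ : ℝ}
    (hV : frontier V ⊆ orbitThickening G ρ) {p q x : Disc N} {R T : ℝ}
    (hp : Wbtw ℝ (0 : Euc N) p x) (hT : T + (R + ρ) ≤ d(origin N, p)) (hpq : d(p, q) < R)
    (hq : q ∈ V) (hx : x ∉ V) : x ∈ orbitShadow G T (2 * (R + ρ)) := by
  by_cases hpV : p ∈ V
  · have hsegment : IsPreconnected {y : Disc N | (y : Euc N) ∈ segment ℝ (p : Euc N) x} :=
      isPreconnected_preimage_val_of_convex (convex_segment _ _)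
    obtain ⟨y, hys, hyV⟩ := exists_mem_frontier_of_isPreconnected hsegment
      (left_mem_segment ℝ _ _) (right_mem_segment ℝ _ _) fun h => hx (h.1 hpV)
    rw [Set.mem_ofPred_eq, mem_segment_iff_wbtw] at hys
    have hpy := hdist_origin_add_hdist_of_wbtw (hp.trans_right_left hys)
    have hR : d(y, y) ≤ R := (hdist_self y).trans_le ((hdist_nonneg p q).trans hpq.le)
    exact mem_orbitShadow_of_wbtw (hp.trans_right hys) (by linarith [hdist_nonneg p y]) hR (hV hyV)
  · obtain ⟨y, hyV, hpy⟩ : ∃ y ∈ frontier V, d(p, y) < R := by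
      by_contra! h
      exact hpV ((mem_iff_mem_of_hdist_lt h hpq).2 hq)
    exact mem_orbitShadow_of_wbtw hp hT hpy.le (hV hyV)

end OrbitShadows

section Endpoints

/-- The hyperbolic distance from the ray towards `ξ` to the complement of `W` tends to infinity
along the ray. -/
def RayDivesInto (W : Set (Disc N)) (ξ : ClosedDisc N) : Prop :=
  ∀ R : ℝ, ∀ᶠ t in atTop, ∀ q ∉ W, R ≤ d(ray ξ t, q)

theorem RayDivesInto.eventually_mem {W : Set (Disc N)} {ξ : ClosedDisc N}
    (h : RayDivesInto W ξ) : ∀ᶠ t in atTop, ray ξ t ∈ W := by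
  filter_upwards [h 1] with t ht
  by_contra hW
  linarith [ht _ hW, hdist_self (ray ξ t)]

theorem ray_mem_connectedComponentIn {W : Set (Disc N)} {ξ : ClosedDisc N} {t₀ t : ℝ}
    (h : ∀ u ≥ t₀, ray ξ u ∈ W) (ht : t₀ ≤ t) :
    ray ξ t ∈ connectedComponentIn W (ray ξ t₀) :=
  (isPreconnected_Ici.image _ (continuous_ray ξ).continuousOn).subset_connectedComponentIn
    (Set.mem_image_of_mem _ Set.self_mem_Ici) (Set.image_subset_iff.2 h) (Set.mem_image_of_mem _ ht)

/-- Every geodesic ray towards `ξ` is at bounded distance from the one from the origin. -/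
theorem RayDivesInto.isEndpoint_connectedComponentIn {W : Set (Disc N)} {ξ : ClosedDisc N}
    (h : RayDivesInto W ξ) (hW : IsOpen W) (hξ : ‖(ξ : Euc N)‖ = 1) {t₀ : ℝ}
    (ht₀ : ∀ t ≥ t₀, ray ξ t ∈ W) : IsEndpoint (connectedComponentIn W (ray ξ t₀)) ξ := by
  refine ⟨hξ, fun β hβ => ?_⟩
  set C := connectedComponentIn W (ray ξ t₀)
  have hfrontier : frontier C ⊆ Wᶜ := frontier_connectedComponentIn_subset_compl hW _
  obtain ⟨K, hK⟩ := hβ.exists_hdist_ray_le hξ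
  have hclose : ∀ᶠ t in atTop, d(β t, ray ξ d(origin N, β t)) ≤ K :=
    (eventually_ge_atTop 0).mono hK
  have hdeep (R : ℝ) : ∀ᶠ t in atTop, ∀ q ∉ W, R ≤ d(ray ξ d(origin N, β t), q) :=
    hβ.tendsto_hdist_origin.eventually (h R)
  constructor
  · filter_upwards [hclose, hdeep (K + 1),
      hβ.tendsto_hdist_origin.eventually_ge_atTop t₀] with t htK hdeep ht
    refine (mem_iff_mem_of_hdist_lt (fun q hq => hdeep q (hfrontier hq)) ?_).1
      (ray_mem_connectedComponentIn ht₀ ht)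
    rw [hdist_comm]; linarith
  · intro R
    filter_upwards [hclose, hdeep (R + K)] with t htK hdeep q hq
    linarith [hdeep q (hfrontier hq), hdist_triangle (ray ξ d(origin N, β t)) (β t) q,
      hdist_comm (ray ξ d(origin N, β t)) (β t)]

theorem tendsto_depth_of_tendsto_incl {ι : Type*} {l : Filter ι} {z : ι → Disc N}
    {ζ : ClosedDisc N} (hζ : ‖(ζ : Euc N)‖ = 1) (hz : Tendsto (fun n => incl (z n)) l (𝓝 ζ)) :
    Tendsto (fun n => depth (z n)) l (𝓝 0) := by
  have h : Tendsto (fun n => 1 - ‖(z n : Euc N)‖ ^ 2) l (𝓝 (1 - ‖(ζ : Euc N)‖ ^ 2)) :=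
    (((continuous_subtype_val.tendsto ζ).comp hz).norm.pow 2).const_sub 1
  rwa [hζ, one_pow, sub_self] at h

theorem tendsto_hdist_origin_of_tendsto_depth {ι : Type*} {l : Filter ι} {z : ι → Disc N}
    (hz : Tendsto (fun n => depth (z n)) l (𝓝 0)) :
    Tendsto (fun n => d(origin N, z n)) l atTop := by
  refine tendsto_atTop.2 fun T => (hz.eventually_lt_const (Real.exp_pos (-T))).mono fun n hn => ?_
  linarith [Real.exp_lt_exp.1 ((exp_neg_le_depth (z n)).trans_lt hn)]

theorem IsEndpoint.eventually_mem {C : Set (Disc N)} {ζ : ClosedDisc N} (hC : IsEndpoint C ζ)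
    {z : ℕ → Disc N} (hz : Tendsto (fun n => incl (z n)) atTop (𝓝 ζ)) {β : ℝ → Disc N}
    (hβ : IsRayTowards β ζ) {K : ℝ} (hK : ∀ n, ∃ t : ℝ, 0 ≤ t ∧ d(z n, β t) ≤ K) :
    ∀ᶠ n in atTop, z n ∈ C := by
  choose t ht0 ht using hK
  have htop : Tendsto t atTop atTop := by
    refine tendsto_atTop_mono (fun n => ?_) (tendsto_atTop_add_const_right _
      (-(d(origin N, β 0) + K))
      (tendsto_hdist_origin_of_tendsto_depth (tendsto_depth_of_tendsto_incl hC.1 hz)))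
    linarith [ht n, hβ.hdist_zero_eq (ht0 n), hdist_triangle (origin N) (β 0) (β (t n)),
      hdist_triangle (origin N) (β (t n)) (z n), hdist_comm (β (t n)) (z n)]
  obtain ⟨hmem, hdeep⟩ := hC.2 β hβ
  filter_upwards [htop.eventually hmem, htop.eventually (hdeep (K + 1))] with n hn hn'
  refine (mem_iff_mem_of_hdist_lt hn' ?_).1 hn
  rw [hdist_comm]
  linarith [ht n]

end Endpoints

section PoincareSeries

theorem conformalDeriv_incl (g : Mob N) (z : Disc N) :
    conformalDeriv g (incl z) = depth (g • z) / depth z := by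
  have hw := depth_pos (g⁻¹ • origin N)
  have hdist : d(z, g⁻¹ • origin N) = d(origin N, g • z) := by
    rw [← hdist_smul_left, hdist_comm]
  have hdef : conformalDeriv g (incl z) =
      depth (g⁻¹ • origin N) / reflDistSq (z : Euc N) (g⁻¹ • origin N : Disc N) := rfl
  have hgz := sq_cosh_half_hdist_origin_mul_depth (g • z)
  rw [← hdist] at hgz
  rw [hdef, ← sq_cosh_half_hdist_mul, div_eq_div_iff _ (depth_pos z).ne']
  · linear_combination -depth z * depth (g⁻¹ • origin N) * hgz
  · exact (mul_pos (by positivity) (mul_pos (depth_pos z) hw)).ne'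

theorem conformalDeriv_pos (g : Mob N) (z : Disc N) : 0 < conformalDeriv g (incl z) := by
  rw [conformalDeriv_incl]
  exact div_pos (depth_pos _) (depth_pos _)

theorem conformalDeriv_origin (g : Mob N) :
    conformalDeriv g (incl (origin N)) = depth (g • origin N) := by
  rw [conformalDeriv_incl, depth_origin, div_one]

theorem conformalDeriv_le_mul (g : Mob N) (x y : Disc N) :
    conformalDeriv g (incl y) ≤
      4 * exp d(x, y) * (depth x / depth y) * conformalDeriv g (incl x) := by
  have hx := depth_pos x
  have hy := depth_pos y
  have h := depth_le_mul_depth (g • x) (g • y)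
  rw [hdist_smul_smul] at h
  rw [conformalDeriv_incl, conformalDeriv_incl, div_le_iff₀ hy]
  calc depth (g • y) ≤ 4 * exp d(x, y) * depth (g • x) := h
    _ = _ := by field_simp

theorem conformalDeriv_le_of_mem_shadow {g h : Mob N} {z : Disc N} {C : ℝ}
    (hz : h • z ∈ shadow C (g • origin N)) :
    conformalDeriv h (incl z) ≤ 4 * exp C * conformalDeriv g (incl (origin N)) *
      conformalDeriv (g⁻¹ * h) (incl z) := by
  have hg := (depth_pos (g • origin N)).le
  rw [conformalDeriv_origin, conformalDeriv_incl, conformalDeriv_incl, mul_div_assoc',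
    div_le_div_iff_of_pos_right (depth_pos z), mul_smul]
  calc depth (h • z) ≤ 4 * exp C * depth (g • origin N) * exp (-d(g • origin N, h • z)) :=
        depth_le_of_mem_shadow hz
    _ ≤ 4 * exp C * depth (g • origin N) * depth (g⁻¹ • h • z) := by
        rw [hdist_smul_left]
        gcongr
        exact exp_neg_le_depth _

theorem ofReal_rpow_le_mul {a b c s : ℝ} (hs : 0 ≤ s) (ha : 0 ≤ a) (hb : 0 ≤ b) (hc : 0 ≤ c)
    (h : a ≤ b * c) :
    ENNReal.ofReal (a ^ s) ≤ ENNReal.ofReal (b ^ s) * ENNReal.ofReal (c ^ s) := by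
  rw [← ENNReal.ofReal_mul (Real.rpow_nonneg hb s), ← Real.mul_rpow hb hc]
  exact ENNReal.ofReal_le_ofReal (Real.rpow_le_rpow ha h hs)

variable {G : Subgroup (Mob N)} {s : ℝ}

theorem poincareSeries_le_mul (hs : 0 ≤ s) (x y : Disc N) :
    poincareSeries G y s ≤
      ENNReal.ofReal ((4 * exp d(x, y) * (depth x / depth y)) ^ s) * poincareSeries G x s := by
  have hxy := div_pos (depth_pos x) (depth_pos y)
  rw [poincareSeries, poincareSeries, ← ENNReal.tsum_mul_left]
  exact ENNReal.tsum_le_tsum fun g => ofReal_rpow_le_mul hs (conformalDeriv_pos _ _).le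
    (by positivity) (conformalDeriv_pos _ _).le (conformalDeriv_le_mul _ x y)

theorem poincareSeries_ne_top (hs : 0 ≤ s) {x : Disc N} (h : poincareSeries G x s < ∞)
    (y : Disc N) : poincareSeries G y s ≠ ∞ :=
  ne_top_of_le_ne_top (ENNReal.mul_ne_top ENNReal.ofReal_ne_top h.ne)
    (poincareSeries_le_mul hs x y)

theorem poincareSeries_ne_zero (z : Disc N) : poincareSeries G z s ≠ 0 := fun h =>
  (ENNReal.ofReal_pos.2 (Real.rpow_pos_of_pos (conformalDeriv_pos _ z) s)).ne'
    (ENNReal.tsum_eq_zero.1 h 1)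

/-- The part of the Poincaré series at the origin that comes from the elements moving the origin by
at least `T`. -/
def poincareTail (G : Subgroup (Mob N)) (s T : ℝ) : ℝ≥0∞ :=
  ∑' g : {g : G | T ≤ d(origin N, (g : Mob N) • origin N)},
    ENNReal.ofReal (conformalDeriv (g : Mob N) (incl (origin N)) ^ s)

theorem tendsto_poincareTail (h : poincareSeries G (origin N) s ≠ ∞) :
    Tendsto (poincareTail G s) atTop (𝓝 0) := by
  refine ENNReal.tendsto_nhds_zero.2 fun ε hε => ?_
  obtain ⟨F, hF⟩ := ((ENNReal.tendsto_tsum_compl_atTop_zero h).eventually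
    (ge_mem_nhds hε)).exists
  have hlarge : ∀ᶠ T in atTop, ∀ g ∈ F, d(origin N, (g : Mob N) • origin N) < T :=
    F.eventually_all.2 fun g _ => eventually_gt_atTop _
  filter_upwards [hlarge] with T hT
  exact (ENNReal.tsum_mono_subtype
    (fun g : G => ENNReal.ofReal (conformalDeriv (g : Mob N) (incl (origin N)) ^ s))
    fun g hg hgF => (hT g hgF).not_ge hg).trans hF

theorem tendsto_depth_smul_cofinite (hs : 0 ≤ s) {x : Disc N} (h : poincareSeries G x s ≠ ∞) :
    Tendsto (fun g : G => depth ((g : Mob N) • x)) cofinite (𝓝 0) := by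
  refine tendsto_order.2 ⟨fun a ha => .of_forall fun g => ha.trans (depth_pos _), fun δ hδ => ?_⟩
  have hδs := ENNReal.ofReal_pos.2 (Real.rpow_pos_of_pos hδ s)
  refine ((ENNReal.finite_const_le_of_tsum_ne_top h hδs.ne').subset fun g hg => ?_)
  rw [Set.mem_compl_iff, Set.mem_ofPred_eq, not_lt] at hg
  have hgx : δ ≤ conformalDeriv (g : Mob N) (incl x) := by
    rw [conformalDeriv_incl]
    exact hg.trans (le_div_self (depth_pos _).le (depth_pos x) (depth_le_one x))
  exact ENNReal.ofReal_le_ofReal (Real.rpow_le_rpow hδ.le hgx hs)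

end PoincareSeries

section OrbitMeasures

variable {G : Subgroup (Mob N)} {s : ℝ}

theorem orbitMeasure_apply (z : Disc N) {V : Set (ClosedDisc N)} (hV : MeasurableSet V) :
    orbitMeasure G s z V = (poincareSeries G z s)⁻¹ * ∑' g : G,
      ENNReal.ofReal (conformalDeriv (g : Mob N) (incl z) ^ s) *
        V.indicator 1 ((g : Mob N) • incl z) := by
  simp only [orbitMeasure, Measure.smul_apply, Measure.sum_apply _ hV, smul_eq_mul,
    Measure.dirac_apply' _ hV]

theorem isProbabilityMeasure_orbitMeasure (z : Disc N) (h : poincareSeries G z s ≠ ∞) :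
    IsProbabilityMeasure (orbitMeasure G s z) := by
  refine ⟨?_⟩
  simp only [orbitMeasure_apply z MeasurableSet.univ, Set.indicator_univ, Pi.one_apply, mul_one]
  exact ENNReal.inv_mul_cancel (poincareSeries_ne_zero z) h

/-- By `conformalDeriv_le_of_mem_shadow`, the mass of `orbitMeasure G s z` in the shadow of `g(0)`
is at most `(4 exp C · j(g, 0))^s` times its total mass. -/
theorem orbitMeasure_le_poincareTail (hs : 0 ≤ s) (z : Disc N) {V : Set (ClosedDisc N)}
    (hV : MeasurableSet V) {T C : ℝ}
    (h : ∀ k ∈ G, k • incl z ∈ V → k • z ∈ orbitShadow G T C) :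
    orbitMeasure G s z V ≤ ENNReal.ofReal ((4 * exp C) ^ s) * poincareTail G s T := by
  set A := ENNReal.ofReal ((4 * exp C) ^ s)
  let j (g : G) (x : Disc N) : ℝ≥0∞ := ENNReal.ofReal (conformalDeriv (g : Mob N) (incl x) ^ s)
  let far : Set G := {g | T ≤ d(origin N, (g : Mob N) • origin N)}
  have hterm (k : G) : j k z * V.indicator 1 ((k : Mob N) • incl z) ≤
      ∑' g : far, A * j g (origin N) * j ((g : G)⁻¹ * k) z := by
    by_cases hk : (k : Mob N) • incl z ∈ V
    · obtain ⟨g, hg, hgT, hgk⟩ := h k k.2 hk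
      have hg0 := (conformalDeriv_pos g (origin N)).le
      rw [Set.indicator_of_mem hk, Pi.one_apply, mul_one]
      refine le_trans ?_ (ENNReal.le_tsum (⟨⟨g, hg⟩, hgT⟩ : far))
      rw [← ENNReal.ofReal_mul (by positivity), ← Real.mul_rpow (by positivity) hg0]
      exact ofReal_rpow_le_mul hs (conformalDeriv_pos _ _).le (by positivity)
        (conformalDeriv_pos _ _).le (conformalDeriv_le_of_mem_shadow hgk)
    · rw [Set.indicator_of_notMem hk, mul_zero]
      exact zero_le
  have htranslate (g : G) : ∑' k : G, j (g⁻¹ * k) z = poincareSeries G z s :=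
    (Equiv.mulLeft g⁻¹).tsum_eq fun k => j k z
  rw [orbitMeasure_apply z hV]
  calc (poincareSeries G z s)⁻¹ * ∑' k : G, j k z * V.indicator 1 ((k : Mob N) • incl z)
      ≤ (poincareSeries G z s)⁻¹ *
          ∑' k : G, ∑' g : far, A * j g (origin N) * j ((g : G)⁻¹ * k) z := by
        gcongr with k; exact hterm k
    _ = (poincareSeries G z s)⁻¹ * (A * poincareTail G s T * poincareSeries G z s) := by
        rw [ENNReal.tsum_comm]
        simp_rw [ENNReal.tsum_mul_left, htranslate, ENNReal.tsum_mul_right, ENNReal.tsum_mul_left]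
        rfl
    _ = A * poincareTail G s T * ((poincareSeries G z s)⁻¹ * poincareSeries G z s) := by ring
    _ ≤ A * poincareTail G s T := mul_le_of_le_one_right zero_le (ENNReal.inv_mul_le_one _)

theorem IsConformalEndingMeasure.poincareSeries_ne_top {z : ℕ → Disc N}
    {μ : Measure (ClosedDisc N)} (hμ : IsConformalEndingMeasure G s z μ) (x : Disc N) :
    poincareSeries G x s ≠ ∞ :=
  hμ.converges.elim fun _ h => ConformalEnding.poincareSeries_ne_top hμ.exponent_pos.le h x

theorem IsConformalEndingMeasure.measure_le_of_isOpen {z : ℕ → Disc N}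
    {μ : Measure (ClosedDisc N)} (hμ : IsConformalEndingMeasure G s z μ)
    {V : Set (ClosedDisc N)} (hV : IsOpen V) {ε : ℝ≥0∞}
    (h : ∀ᶠ n in atTop, orbitMeasure G s (z n) V ≤ ε) : μ V ≤ ε := by
  obtain ⟨φ, hφ, hlim⟩ := hμ.weakLimit
  let ν (n : ℕ) : ProbabilityMeasure (ClosedDisc N) := ⟨orbitMeasure G s (z (φ n)),
    isProbabilityMeasure_orbitMeasure _ (hμ.poincareSeries_ne_top _)⟩
  have hν : Tendsto ν atTop (𝓝 ⟨μ, hμ.isProbabilityMeasure⟩) :=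
    ProbabilityMeasure.tendsto_iff_forall_integral_tendsto.2 fun f => hlim f.toContinuousMap
  refine (ProbabilityMeasure.le_liminf_measure_open_of_tendsto hν hV).trans ?_
  exact liminf_le_of_frequently_le' (hφ.tendsto_atTop.eventually h).frequently

theorem IsConformalEndingMeasure.measure_le_poincareTail {z : ℕ → Disc N}
    {μ : Measure (ClosedDisc N)} (hμ : IsConformalEndingMeasure G s z μ)
    {V : Set (ClosedDisc N)} (hV : IsOpen V) {T C : ℝ}
    (h : ∀ᶠ n in atTop, ∀ k ∈ G, k • incl (z n) ∈ V → k • z n ∈ orbitShadow G T C) :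
    μ V ≤ ENNReal.ofReal ((4 * exp C) ^ s) * poincareTail G s T :=
  hμ.measure_le_of_isOpen hV (h.mono fun _ =>
    orbitMeasure_le_poincareTail hμ.exponent_pos.le _ hV.measurableSet)

end OrbitMeasures

section LimitSets

theorem tendsto_incl_of_norm_sub_sq_le {ι : Type*} {l : Filter ι} {x y : ι → Disc N}
    {ξ : ClosedDisc N} (hx : Tendsto (fun i => incl (x i)) l (𝓝 ξ)) {f : ι → ℝ}
    (hf : Tendsto f l (𝓝 0)) (h : ∀ i, ‖(x i : Euc N) - y i‖ ^ 2 ≤ f i) :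
    Tendsto (fun i => incl (y i)) l (𝓝 ξ) := by
  have hsq : Tendsto (fun i => ‖(x i : Euc N) - y i‖ ^ 2) l (𝓝 0) :=
    squeeze_zero (fun _ => sq_nonneg _) h hf
  have hdist : Tendsto (fun i => dist (incl (x i)) (incl (y i))) l (𝓝 0) := by
    refine squeeze_zero (fun _ => dist_nonneg) (fun i => ?_) (Real.sqrt_zero ▸ hsq.sqrt)
    rw [Real.sqrt_sq (norm_nonneg _), ← dist_eq_norm]
    rfl
  exact tendsto_of_tendsto_of_dist hx hdist

theorem tendsto_incl_smul {ι : Type*} {l : Filter ι} {e : ι → Mob N} {x : Disc N}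
    {ξ : ClosedDisc N} (hξ : ‖(ξ : Euc N)‖ = 1)
    (h : Tendsto (fun i => incl (e i • x)) l (𝓝 ξ)) (y : Disc N) :
    Tendsto (fun i => incl (e i • y)) l (𝓝 ξ) := by
  have hdepth := (tendsto_depth_of_tendsto_incl hξ h).const_mul (exp d(x, y))
  rw [mul_zero] at hdepth
  refine tendsto_incl_of_norm_sub_sq_le h hdepth fun i => ?_
  rw [← hdist_smul_smul (e i) x y]
  exact norm_sub_sq_le_mul_depth (e i • x) (e i • y)

theorem mem_closure_orbit_of_mem_closure_orbit {H : Subgroup (Mob N)} {x : Disc N}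
    {ξ : ClosedDisc N} (hξ : ‖(ξ : Euc N)‖ = 1)
    (h : ξ ∈ closure (incl '' MulAction.orbit H x)) (y : Disc N) :
    ξ ∈ closure (incl '' MulAction.orbit H y) := by
  obtain ⟨u, hu, hlim⟩ := mem_closure_iff_seq_limit.1 h
  choose v hv hvu using hu
  choose g hg using hv
  have hgx : Tendsto (fun n => incl ((g n : Mob N) • x)) atTop (𝓝 ξ) :=
    hlim.congr fun n => by rw [← hvu, ← hg]; rfl
  exact mem_closure_of_tendsto (tendsto_incl_smul hξ hgx y)
    (.of_forall fun n => ⟨_, ⟨g n, rfl⟩, rfl⟩)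

theorem mem_limitSet_iff {H : Subgroup (Mob N)} {ξ : ClosedDisc N} (hξ : ‖(ξ : Euc N)‖ = 1)
    (x : Disc N) : ξ ∈ limitSet H ↔ ξ ∈ closure (incl '' MulAction.orbit H x) := by
  have horbit : {y | ∃ g ∈ H, y = g • incl (origin N)} =
      incl '' MulAction.orbit H (origin N) := by
    ext y
    constructor
    · rintro ⟨g, hg, rfl⟩
      exact ⟨_, ⟨⟨g, hg⟩, rfl⟩, rfl⟩
    · rintro ⟨_, ⟨g, rfl⟩, rfl⟩
      exact ⟨g, g.2, rfl⟩
  have hξ' : ξ ∉ incl '' MulAction.orbit H (origin N) := by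
    rintro ⟨y, -, rfl⟩
    exact (mem_ball_zero_iff.1 y.2).ne hξ
  rw [limitSet, horbit]
  refine ⟨fun h => mem_closure_orbit_of_mem_closure_orbit hξ (derivedSet_subset_closure _ h) x,
    fun h => accPt_iff_frequently.2 ?_⟩
  have h0 := mem_closure_orbit_of_mem_closure_orbit hξ h (origin N)
  exact (mem_closure_iff_frequently.1 h0).mono fun y hy => ⟨fun hyξ => hξ' (hyξ ▸ hy), hy⟩

theorem mem_limitSet_of_tendsto {ι : Type*} {l : Filter ι} [l.NeBot] {H : Subgroup (Mob N)}
    {e : ι → Mob N} (he : ∀ᶠ i in l, e i ∈ H) {x : Disc N} {ξ : ClosedDisc N}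
    (hξ : ‖(ξ : Euc N)‖ = 1) (h : Tendsto (fun i => incl (e i • x)) l (𝓝 ξ)) :
    ξ ∈ limitSet H :=
  (mem_limitSet_iff hξ x).2 (mem_closure_of_tendsto h
    (he.mono fun i hi => ⟨_, ⟨⟨e i, hi⟩, rfl⟩, rfl⟩))

theorem norm_smul_eq_one (g : Mob N) {ζ : ClosedDisc N} (hζ : ‖(ζ : Euc N)‖ = 1) :
    ‖((g • ζ : ClosedDisc N) : Euc N)‖ = 1 :=
  (mem_closedBall_zero_iff.1 (g • ζ).2).eq_of_not_lt fun h => ((g.2.1 ζ).1 h).ne hζ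

variable {G : Subgroup (Mob N)} {C C' : Set (Disc N)}

theorem conj_mem_endGroup_smul {k g : Mob N} (hk : k ∈ G) (hg : g ∈ endGroup G C) :
    k * g * k⁻¹ ∈ endGroup G (k • C) := by
  obtain ⟨hgG, hgC⟩ := Subgroup.mem_inf.1 hg
  refine Subgroup.mem_inf.2 ⟨mul_mem (mul_mem hk hgG) (inv_mem hk), ?_⟩
  rw [MulAction.mem_stabilizer_iff] at hgC ⊢
  rw [smul_smul, inv_mul_cancel_right, mul_smul, hgC]

theorem smul_mem_limitSet_endGroup {ζ : ClosedDisc N} (hζ : ‖(ζ : Euc N)‖ = 1)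
    (h : ζ ∈ limitSet (endGroup G C)) {k : Mob N} (hk : k ∈ G) :
    k • ζ ∈ limitSet (endGroup G (k • C)) := by
  rw [mem_limitSet_iff (norm_smul_eq_one k hζ) (k • origin N)]
  refine map_mem_closure (continuous_const_smul k) ((mem_limitSet_iff hζ (origin N)).1 h) ?_
  rintro _ ⟨_, ⟨g, rfl⟩, rfl⟩
  refine ⟨_, ⟨⟨_, conj_mem_endGroup_smul hk g.2⟩, rfl⟩, ?_⟩
  change incl ((k * g * k⁻¹) • k • origin N) = k • incl ((g : Mob N) • origin N)
  rw [smul_smul, inv_mul_cancel_right, mul_smul, incl_smul]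

/-- The closed Dirichlet domain of `G` centred at `a`, without the condition of
`IsDirichletDomain` on the stabiliser of `a`. -/
def dirichletDomain (G : Subgroup (Mob N)) (a : Disc N) : Set (Disc N) :=
  {z | ∀ g ∈ G, d(z, a) ≤ d(z, g • a)}

theorem hdist_smul_smul_le_of_mem_dirichletDomain {a z : Disc N} (hz : z ∈ dirichletDomain G a)
    {g : Mob N} (hg : g ∈ G) : d(g • z, g • a) ≤ d(g • z, a) := by
  rw [hdist_smul_smul, hdist_smul_left]
  exact hz _ (inv_mem hg)

theorem norm_sub_sq_le_of_hdist_le {x y a : Disc N} (h : d(x, y) ≤ d(x, a)) :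
    ‖(x : Euc N) - y‖ ^ 2 ≤ 4 / depth a * depth y := by
  have hx := depth_pos x
  have hy := depth_pos y
  have hdiam : ‖(x : Euc N) - a‖ ≤ 2 := by
    linarith [norm_sub_le (x : Euc N) a, mem_ball_zero_iff.1 x.2, mem_ball_zero_iff.1 a.2]
  have hsinh : sinh (d(x, y) / 2) ≤ sinh (d(x, a) / 2) := Real.sinh_le_sinh.2 (by linarith)
  have hsinh0 : 0 ≤ sinh (d(x, y) / 2) :=
    Real.sinh_nonneg_iff.2 (div_nonneg (hdist_nonneg x y) two_pos.le)
  rw [div_mul_eq_mul_div, le_div_iff₀ (depth_pos a)]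
  calc ‖(x : Euc N) - y‖ ^ 2 * depth a
      = sinh (d(x, y) / 2) ^ 2 * (depth x * depth y) * depth a := by rw [sq_sinh_half_hdist_mul]
    _ ≤ sinh (d(x, a) / 2) ^ 2 * (depth x * depth y) * depth a := by
        have := (depth_pos a).le
        gcongr
    _ = ‖(x : Euc N) - a‖ ^ 2 * depth y := by rw [← sq_sinh_half_hdist_mul]; ring
    _ ≤ 2 ^ 2 * depth y := by gcongr
    _ = 4 * depth y := by norm_num

theorem mem_endGroup_of_smul_eq {g h : Mob N} (hg : g ∈ G) (hh : h ∈ G) (hgC : g • C = C')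
    (hhC : h • C = C') : g * h⁻¹ ∈ endGroup G C' := by
  refine Subgroup.mem_inf.2 ⟨mul_mem hg (inv_mem hh), ?_⟩
  rw [MulAction.mem_stabilizer_iff, mul_smul, inv_smul_eq_iff.2 hhC.symm, hgC]

variable {a : Disc N} {ζ ξ : ClosedDisc N}

theorem mem_limitSet_endGroup_of_tendsto_cofinite {ι : Type*} {l : Filter ι} [l.NeBot]
    (hG : Tendsto (fun g : G => depth ((g : Mob N) • a)) cofinite (𝓝 0)) {e : ι → G}
    (he : Tendsto e l cofinite) (heC : ∀ᶠ i in l, (e i : Mob N) • C = C') {z : ι → Disc N}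
    (hz : ∀ i, z i ∈ dirichletDomain G a) (hξ : ‖(ξ : Euc N)‖ = 1)
    (hlim : Tendsto (fun i => incl ((e i : Mob N) • z i)) l (𝓝 ξ)) :
    ξ ∈ limitSet (endGroup G C') := by
  obtain ⟨i₀, hi₀⟩ := heC.exists
  have hdepth := (hG.comp he).const_mul (4 / depth a)
  rw [mul_zero] at hdepth
  have hcenter : Tendsto (fun i => incl ((e i : Mob N) • a)) l (𝓝 ξ) :=
    tendsto_incl_of_norm_sub_sq_le hlim hdepth fun i =>
      norm_sub_sq_le_of_hdist_le (hdist_smul_smul_le_of_mem_dirichletDomain (hz i) (e i).2)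
  refine mem_limitSet_of_tendsto (x := (e i₀ : Mob N) • a)
    (heC.mono fun i hi => mem_endGroup_of_smul_eq (e i).2 (e i₀).2 hi hi₀) hξ ?_
  simpa only [mul_smul, inv_smul_smul] using hcenter

/-- Along an ultrafilter, `e` either tends to infinity in `G` or is constant. -/
theorem mem_limitSet_endGroup_of_tendsto {ι : Type*} {l : Filter ι} [l.NeBot]
    (hG : Tendsto (fun g : G => depth ((g : Mob N) • a)) cofinite (𝓝 0)) {e : ι → G}
    (heC : ∀ᶠ i in l, (e i : Mob N) • C = C') {z : ι → Disc N}
    (hz : ∀ i, z i ∈ dirichletDomain G a) (hζ : ‖(ζ : Euc N)‖ = 1)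
    (hzζ : Tendsto (fun i => incl (z i)) l (𝓝 ζ)) (hζC : ζ ∈ limitSet (endGroup G C))
    (hξ : ‖(ξ : Euc N)‖ = 1) (hlim : Tendsto (fun i => incl ((e i : Mob N) • z i)) l (𝓝 ξ)) :
    ξ ∈ limitSet (endGroup G C') := by
  have hU : (Ultrafilter.of l : Filter ι) ≤ l := Ultrafilter.of_le l
  rcases ((Ultrafilter.of l).map e).le_cofinite_or_eq_pure with hcofinite | ⟨k, hk⟩
  · exact mem_limitSet_endGroup_of_tendsto_cofinite hG hcofinite (hU heC) hz hξ (hlim.mono_left hU)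
  · have hek : ∀ᶠ i in (Ultrafilter.of l : Filter ι), e i = k :=
      tendsto_pure.1 (congrArg Ultrafilter.toFilter hk).le
    have hlim' : Tendsto (fun i => incl ((e i : Mob N) • z i)) (Ultrafilter.of l : Filter ι)
        (𝓝 ((k : Mob N) • ζ)) :=
      ((hzζ.mono_left hU).const_smul (k : Mob N)).congr' (hek.mono fun i hi => by rw [← hi]; rfl)
    obtain ⟨i, rfl, hkC⟩ := (hek.and (hU heC)).exists
    rw [tendsto_nhds_unique (hlim.mono_left hU) hlim', ← hkC]
    exact smul_mem_limitSet_endGroup hζ hζC (e i).2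

theorem exists_isOpen_forall_smul_notMem
    (hG : Tendsto (fun g : G => depth ((g : Mob N) • a)) cofinite (𝓝 0)) {z : ℕ → Disc N}
    (hz : ∀ n, z n ∈ dirichletDomain G a) (hζ : ‖(ζ : Euc N)‖ = 1)
    (hzζ : Tendsto (fun n => incl (z n)) atTop (𝓝 ζ)) (hzC : ∀ᶠ n in atTop, z n ∈ C)
    (hζC : ζ ∈ limitSet (endGroup G C)) (hCC' : ∀ g ∈ G, ∀ y ∈ C, g • y ∈ C' → g • C = C')
    (hξ : ‖(ξ : Euc N)‖ = 1) (hξC : ξ ∉ limitSet (endGroup G C')) :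
    ∃ O : Set (ClosedDisc N), IsOpen O ∧ ξ ∈ O ∧
      ∀ᶠ n in atTop, ∀ g ∈ G, g • incl (z n) ∈ O → g • z n ∉ C' := by
  let l : Filter (ℕ × G) :=
    comap Prod.fst atTop ⊓ comap (fun p => incl ((p.2 : Mob N) • z p.1)) (𝓝 ξ)
  let S : Set (ℕ × G) := {p | (p.2 : Mob N) • z p.1 ∈ C'}
  have hfst : Tendsto Prod.fst (l ⊓ 𝓟 S) atTop :=
    tendsto_comap.mono_left (inf_le_left.trans inf_le_left)
  have hlS : ¬ (l ⊓ 𝓟 S).NeBot := fun _ => hξC <|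
    mem_limitSet_endGroup_of_tendsto hG (e := Prod.snd) (z := z ∘ Prod.fst)
      ((hfst.eventually hzC).mp (eventually_inf_principal.2 (.of_forall fun p hp hzp =>
        hCC' _ p.2.2 _ hzp hp)))
      (fun p => hz p.1) hζ (hzζ.comp hfst) hζC hξ
      (tendsto_comap.mono_left (inf_le_left.trans inf_le_right))
  have hl : ∀ᶠ p in l, p ∈ Sᶜ := inf_principal_eq_bot.1 (not_neBot.1 hlS)
  obtain ⟨⟨n₀, O⟩, ⟨-, hξO, hO⟩, h⟩ :=
    ((atTop_basis.comap _).inf ((nhds_basis_opens ξ).comap _)).eventually_iff.1 hl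
  exact ⟨O, hO, hξO, (eventually_ge_atTop n₀).mono fun n hn g hg hgO => @h (n, ⟨g, hg⟩) ⟨hn, hgO⟩⟩

end LimitSets

section EndingMeasures

variable {G : Subgroup (Mob N)} {s : ℝ} {E : Set (Orbifold G)} {z : ℕ → Disc N}
  {μ : Measure (ClosedDisc N)} {a : Disc N} {ζ : ClosedDisc N}

theorem depth_smul_le_of_mem_dirichletDomain {x : Disc N} (hx : x ∈ dirichletDomain G a)
    {g : Mob N} (hg : g ∈ G) : depth (g • x) ≤ 4 * exp (2 * d(origin N, a)) * depth x := by
  have hxa : d(x, a) ≤ d(g • x, a) := (hdist_smul_smul g x a).symm.trans_le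
    (hdist_smul_smul_le_of_mem_dirichletDomain hx hg)
  have hdist : d(origin N, x) - 2 * d(origin N, a) ≤ d(origin N, g • x) := by
    linarith [hdist_triangle (g • x) (origin N) a, hdist_triangle (origin N) a x,
      hdist_comm a x, hdist_comm (g • x) (origin N)]
  calc depth (g • x) ≤ 4 * exp (-d(origin N, g • x)) := depth_le_exp_neg _
    _ ≤ 4 * exp (2 * d(origin N, a) + -d(origin N, x)) := by gcongr; linarith
    _ = 4 * exp (2 * d(origin N, a)) * exp (-d(origin N, x)) := by rw [Real.exp_add]; ring
    _ ≤ 4 * exp (2 * d(origin N, a)) * depth x := by gcongr; exact exp_neg_le_depth x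

theorem IsConformalEndingMeasure.ae_norm_eq_one (hμ : IsConformalEndingMeasure G s z μ)
    (hz : ∀ n, z n ∈ dirichletDomain G a) (hdepth : Tendsto (fun n => depth (z n)) atTop (𝓝 0)) :
    ∀ᵐ ξ : ClosedDisc N ∂μ, ‖(ξ : Euc N)‖ = 1 := by
  have hnull (δ : ℝ) (hδ : 0 < δ) : ∀ᵐ ξ : ClosedDisc N ∂μ, 1 - ‖(ξ : Euc N)‖ ^ 2 ≤ δ := by
    let V : Set (ClosedDisc N) := {ξ | δ < 1 - ‖(ξ : Euc N)‖ ^ 2}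
    have hV : IsOpen V := isOpen_lt continuous_const (by fun_prop)
    have hlim := hdepth.const_mul (4 * exp (2 * d(origin N, a)))
    rw [mul_zero] at hlim
    suffices h : ∀ᶠ n in atTop, orbitMeasure G s (z n) V ≤ 0 by
      simpa only [ae_iff, not_le] using nonpos_iff_eq_zero.1 (hμ.measure_le_of_isOpen hV h)
    filter_upwards [hlim.eventually_le_const hδ] with n hn
    have hnotMem (g : G) : (g : Mob N) • incl (z n) ∉ V := fun hg =>
      (lt_of_lt_of_le hg (depth_smul_le_of_mem_dirichletDomain (hz n) g.2)).not_ge hn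
    simp only [orbitMeasure_apply (z n) hV.measurableSet, Set.indicator_of_notMem (hnotMem _),
      mul_zero, tsum_zero, le_refl]
  filter_upwards [ae_all_iff.2 fun m : ℕ => hnull (1 / ((m : ℝ) + 1)) Nat.one_div_pos_of_nat]
    with ξ hξ
  have hle : 1 - ‖(ξ : Euc N)‖ ^ 2 ≤ 0 :=
    ge_of_tendsto' tendsto_one_div_add_atTop_nhds_zero_nat hξ
  exact le_antisymm (mem_closedBall_zero_iff.1 ξ.2)
    ((one_le_sq_iff₀ (norm_nonneg _)).1 (sub_nonpos.1 hle))

theorem IsConformalEndingMeasure.measure_eq_zero_of_orbitShadow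
    (hμ : IsConformalEndingMeasure G s z μ) {B : Set (ClosedDisc N)} {C : ℝ}
    (h : ∀ T : ℝ, ∃ V : Set (ClosedDisc N), IsOpen V ∧ B ⊆ V ∧
      ∀ᶠ n in atTop, ∀ k ∈ G, k • incl (z n) ∈ V → k • z n ∈ orbitShadow G T C) :
    μ B = 0 := by
  have hbound (T : ℝ) : μ B ≤ ENNReal.ofReal ((4 * exp C) ^ s) * poincareTail G s T := by
    obtain ⟨V, hV, hBV, hshadow⟩ := h T
    exact (measure_mono hBV).trans (hμ.measure_le_poincareTail hV hshadow)
  have hlim := ENNReal.Tendsto.const_mul (tendsto_poincareTail (hμ.poincareSeries_ne_top _))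
    (Or.inr (ENNReal.ofReal_ne_top (r := (4 * exp C) ^ s)))
  rw [mul_zero] at hlim
  exact nonpos_iff_eq_zero.1 (ge_of_tendsto' hlim hbound)

theorem isOpen_setOf_hdist_ray_lt (t R : ℝ) (q : Disc N) :
    IsOpen {ξ : ClosedDisc N | d(ray ξ t, q) < R} :=
  (isOpen_lt (continuous_hdist_left q) continuous_const).preimage (continuous_ray_left t)

theorem isOpen_setOf_lt_hdist_origin_ray (t R : ℝ) :
    IsOpen {ξ : ClosedDisc N | R < d(origin N, ray ξ t)} := by
  simp_rw [hdist_comm (origin N)]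
  exact (isOpen_lt continuous_const (continuous_hdist_left _)).preimage (continuous_ray_left t)

/-- If `k z_n` is close to such a `ξ`, then the segment from the origin to `k z_n` comes close to
`A` far from the origin, although `k z_n ∉ A`. -/
theorem IsConformalEndingMeasure.measure_setOf_frequently_hdist_ray_lt_eq_zero
    (hμ : IsConformalEndingMeasure G s z μ) {A : Set (Disc N)} {ρ : ℝ}
    (hA : frontier A ⊆ orbitThickening G ρ) {O : Set (ClosedDisc N)} (hO : IsOpen O)
    (hzA : ∀ᶠ n in atTop, ∀ k ∈ G, k • incl (z n) ∈ O → k • z n ∉ A) (R : ℝ) :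
    μ {ξ | ξ ∈ O ∧ ‖(ξ : Euc N)‖ = 1 ∧ ∃ᶠ t in atTop, ∃ q ∈ A, d(ray ξ t, q) < R} = 0 := by
  refine hμ.measure_eq_zero_of_orbitShadow (C := 2 * (R + ρ)) fun T => ?_
  let U (t : ℝ) (q : Disc N) : Set (ClosedDisc N) :=
    {ξ | T + (R + ρ) < d(origin N, ray ξ t)} ∩ {ξ | d(ray ξ t, q) < R}
  refine ⟨O ∩ ⋃ t ∈ Set.Ici (0 : ℝ), ⋃ q ∈ A, U t q, ?_, ?_, ?_⟩
  · exact hO.inter (isOpen_biUnion fun t _ => isOpen_biUnion fun q _ =>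
      (isOpen_setOf_lt_hdist_origin_ray t _).inter (isOpen_setOf_hdist_ray_lt t R q))
  · rintro ξ ⟨hξO, hξ, hfreq⟩
    obtain ⟨t, ⟨q, hqA, hq⟩, ht, hT⟩ := (hfreq.and_eventually
      ((eventually_ge_atTop 0).and (eventually_gt_atTop (T + (R + ρ))))).exists
    refine ⟨hξO, Set.mem_biUnion ht (Set.mem_biUnion hqA ⟨?_, hq⟩)⟩
    rwa [Set.mem_ofPred_eq, hdist_origin_ray hξ ht]
  · filter_upwards [hzA] with n hn k hk ⟨hkO, hkU⟩
    simp only [Set.mem_iUnion] at hkU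
    obtain ⟨t, ht, q, hqA, hT, hq⟩ := hkU
    exact mem_orbitShadow_of_mem_of_notMem hA (wbtw_ray_incl (k • z n) ht) (le_of_lt hT) hq hqA
      (hn k hk hkO)

theorem IsConformalEndingMeasure.ae_rayDivesInto (hμ : IsConformalEndingMeasure G s z μ)
    (hE : IsCompact (frontier E)) (hz : ∀ᶠ n in atTop, z n ∈ proj G ⁻¹' E) :
    ∀ᵐ ξ : ClosedDisc N ∂μ, ‖(ξ : Euc N)‖ = 1 → RayDivesInto (proj G ⁻¹' E) ξ := by
  obtain ⟨ρ, hρ⟩ := exists_frontier_preimage_proj_subset hE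
  rw [← frontier_compl] at hρ
  have hzE : ∀ᶠ n in atTop, ∀ k ∈ G, k • incl (z n) ∈ Set.univ → k • z n ∉ (proj G ⁻¹' E)ᶜ :=
    hz.mono fun n hn k hk _ hkE => hkE (by rwa [Set.mem_preimage, proj_smul hk])
  have hR (R : ℕ) : ∀ᵐ ξ : ClosedDisc N ∂μ, ‖(ξ : Euc N)‖ = 1 →
      ∀ᶠ t in atTop, ∀ q ∉ proj G ⁻¹' E, (R : ℝ) ≤ d(ray ξ t, q) := by
    refine measure_mono_null (fun ξ hξ => ?_)
      (hμ.measure_setOf_frequently_hdist_ray_lt_eq_zero hρ isOpen_univ hzE R)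
    simp only [Set.mem_compl_iff, Set.mem_ofPred_eq, Classical.not_imp, not_eventually,
      not_forall, not_le] at hξ
    exact ⟨Set.mem_univ ξ, hξ.1, hξ.2.mono fun t ⟨q, hq, hqR⟩ => ⟨q, hq, hqR⟩⟩
  filter_upwards [ae_all_iff.2 hR] with ξ hξ hξ1 R
  obtain ⟨m, hm⟩ := exists_nat_ge R
  exact (hξ m hξ1).mono fun t ht q hq => hm.trans (ht q hq)

/-- Near a point of `𝕊` that is not a limit point of the end group of `C'` there are eventually no
points of `C'` in the orbits of the `z_n`. -/
theorem IsConformalEndingMeasure.ae_mem_limitSet_endGroup (hμ : IsConformalEndingMeasure G s z μ)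
    (hEo : IsOpen E) (hE : IsCompact (frontier E)) (hz : ∀ n, z n ∈ dirichletDomain G a)
    (hζ : ‖(ζ : Euc N)‖ = 1) (hzζ : Tendsto (fun n => incl (z n)) atTop (𝓝 ζ))
    {C C' : Set (Disc N)} (hC : IsLift G E C) (hC' : IsLift G E C')
    (hzC : ∀ᶠ n in atTop, z n ∈ C) (hζC : ζ ∈ limitSet (endGroup G C)) :
    ∀ᵐ ξ : ClosedDisc N ∂μ, ‖(ξ : Euc N)‖ = 1 → (∃ᶠ t in atTop, ray ξ t ∈ C') →
      ξ ∈ limitSet (endGroup G C') := by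
  obtain ⟨ρ, hρ⟩ := exists_frontier_preimage_proj_subset hE
  refine measure_null_of_locally_null _ fun ξ hξ => ?_
  simp only [Set.mem_compl_iff, Set.mem_ofPred_eq, Classical.not_imp] at hξ
  obtain ⟨O, hO, hξO, hzO⟩ := exists_isOpen_forall_smul_notMem
    (tendsto_depth_smul_cofinite hμ.exponent_pos.le (hμ.poincareSeries_ne_top a)) hz hζ hzζ hzC hζC
    (fun g hg y hy hgy => hC.smul_eq hC' hg hy hgy) hξ.1 hξ.2.2
  refine ⟨_, inter_mem_nhdsWithin _ (hO.mem_nhds hξO), measure_mono_null ?_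
    (hμ.measure_setOf_frequently_hdist_ray_lt_eq_zero
      ((hC'.frontier_subset hEo).trans hρ) hO hzO 1)⟩
  rintro η ⟨hη, hηO⟩
  simp only [Set.mem_compl_iff, Set.mem_ofPred_eq, Classical.not_imp] at hη
  exact ⟨hηO, hη.1, hη.2.1.mono fun t ht => ⟨_, ht, (hdist_self _).trans_lt one_pos⟩⟩

end EndingMeasures

end ConformalEnding

end

open ConformalEnding in
theorem mainTheorem11_general {N : ℕ} {G : Subgroup (Mob N)} {E : Set (Orbifold G)}
    (hEo : IsOpen E) (hE : IsCompact (frontier E)) {ζ : ClosedDisc N} (hζ : ζ ∈ endLimitSet G E)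
    {z : ℕ → Disc N} (hz : IsEndingSequence G z ζ) {s : ℝ} {μ : Measure (ClosedDisc N)}
    (hμ : IsConformalEndingMeasure G s z μ) : ∀ᵐ ξ ∂μ, ξ ∈ endLimitSet G E := by
  obtain ⟨C, hC, hend, hζC⟩ := hζ
  obtain ⟨_, ⟨a, -, rfl⟩, hzF, hzζ, β, hβ, -, K, hK⟩ := hz
  have hzC := hend.eventually_mem hzζ hβ hK
  filter_upwards [hμ.ae_norm_eq_one hzF (tendsto_depth_of_tendsto_incl hend.1 hzζ),
    hμ.ae_rayDivesInto hE (hzC.mono fun n hn => hC.subset hn),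
    (ae_ball_iff (countable_setOf_isLift hEo)).2 fun C' hC' =>
      hμ.ae_mem_limitSet_endGroup hEo hE hzF hend.1 hzζ hC hC' hzC hζC] with ξ hξ hdives hlimit
  obtain ⟨t₀, ht₀⟩ := eventually_atTop.1 (hdives hξ).eventually_mem
  have hlift : IsLift G E (connectedComponentIn (proj G ⁻¹' E) (ray ξ t₀)) :=
    ⟨_, ht₀ t₀ le_rfl, rfl⟩
  refine ⟨_, hlift,
    (hdives hξ).isEndpoint_connectedComponentIn (hEo.preimage continuous_proj) hξ ht₀,
    hlimit _ hlift hξ (Eventually.frequently ?_)⟩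
  filter_upwards [eventually_ge_atTop t₀] with t ht using ray_mem_connectedComponentIn ht₀ ht

open ConformalEnding in
theorem mainTheorem11 (N : ℕ) (hN : 1 ≤ N) (G : Subgroup (Mob N)) (hG : IsKleinian G)
    (E : Set (Orbifold G)) (hE : IsEnd G E) (hcount : (endLimitSet G E).Countable)
    (ζ : ClosedDisc N) (hζ : ζ ∈ endLimitSet G E)
    (z : ℕ → Disc N) (hz : IsEndingSequence G z ζ)
    (s : ℝ) (μ : Measure (ClosedDisc N)) (hμ : IsConformalEndingMeasure G s z μ) :
    IsPurelyAtomic μ :=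
  ⟨_, hcount, ae_iff.1 (mainTheorem11_general hE.isOpen hE.isCompact_frontier hζ hz hμ)⟩
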